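/- **Setting.** Let $e_1=E_{12}$, $e_2=E_{13}$, $f_1=E_{21}$, $f_2=E_{31}$, $e=E_{23}$, $f=E_{32}$, $h=E_{22}-E_{33}$, $h_0=\mathrm{diag}(1,-\tfrac12,-\tfrac12)$ in $\mathfrak{sl}(3)$; let $\mathfrak p=\mathfrak l\oplus\mathfrak u$ with $\mathfrak l=\langle h_0,e,h,f\rangle$, $\mathfrak u=\langle e_1,e_2\rangle$, and $\bar{\mathfrak u}=\langle f_1,f_2\rangle$ with linear coordinates $(\hat x,\hat y)$. Characters $\lambda\widetilde\omega_1$ of $\mathfrak p$ ($\widetilde\omega_1(Z)=Z_{11}$) are written $\lambda$; $\rho=\tfrac32$. The metaplectic module $\mathbb S_\lambda$ is $\mathbb C[q]$ with $e,h,f$ acting by $\tfrac i2\partial_q^2,\ -q\partial_q-\tfrac12,\ \tfrac i2q^2$, $h_0$ by $\lambda$, $\mathfrak u$ by $0$. The dual metaplectic module $\mathbb S^*_\lambda$ is $\mathbb C[q]$ with $e,h,f$ acting by $-\tfrac i2q^2,\ q\partial_q+\tfrac12,\ -\tfrac i2\partial_q^2$, $h_0$ by $\lambda$, $\mathfrak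 u$ by $0$. Put $(p,r)=p(\partial_q)r|_{q=0}$. For a $\mathfrak p$-module with action $\sigma_{\lambda+\rho}$ the induced action of $X\in\mathfrak{sl}(3)$ in the non-compact picture is $$\varphi\mapsto -(Y_{21}\partial_{\hat x}+Y_{31}\partial_{\hat y})\varphi+\sigma_{\lambda+\rho}(Y_{\mathfrak p})\varphi,\qquad Y=\exp(-u)X\exp(u),\quad u=\hat xf_1+\hat yf_2,$$ where $Y_{\mathfrak p}$ is the $\mathfrak p$-component of $Y$ along $\mathfrak{sl}(3)=\bar{\mathfrak u}\oplus\mathfrak p$. It is denoted $\pi_\lambda$ for $\mathbb S_{\lambda+\rho}$ and $\pi^*_\lambda$ for $\mathbb S^*_{\lambda+\rho}$. The generalized Verma module $M(\mathbb S_{\lambda-\rho})$ is realized on $\mathbb C[x,y]\otimes\mathbb S$ by $\hat\pi_\lambda$, obtained from $\pi_\lambda$ by $\hat x\mapsto-\partial_x$, $\hat y\mapsto-\partial_y$, $\partial_{\hat x}\mapsto x$, $\partial_{\hat y}\mapsto y$. Singular vectors are the vectors annihilated by $\hat\pi_\lambda(\mathfrak u)$. Put $X_s=y\partial_q+ixq$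 and $D_s=iq\partial_{\hat y}-\partial_{\hat x}\partial_q$, the latter acting on $C^\infty(\bar{\mathfrak u}(\mathbb R),\mathbb S^*)=C^\infty(\mathbb R^2)\otimes\mathbb C[q]$. For $T\in\mathbb C[x,y]\otimes\mathbb S$ and $\varphi\in C^\infty(\bar{\mathfrak u}(\mathbb R),\mathbb S^*)$ let $\langle T,\varphi\rangle$ be the bilinear pairing with $\langle P\otimes p,g\otimes r\rangle=\big(P(-\partial_{\hat x},-\partial_{\hat y})g\big)(0)\,(p,r)$. Let $\widetilde G=\widetilde{\mathrm{SL}}(3,\mathbb R)$ be the universal (double) cover of $\mathrm{SL}(3,\mathbb R)$ and $\widetilde P\subset\widetilde G$ the stabilizer of the ray of the first basis vector, so that $\widetilde G/\widetilde P\simeq S^2$ is the double cover of $\mathbb{RP}^2$. At the group level $\mathbb S^*_\mu$ denotes the Schwartz space $\mathcal S(\mathbb R)$ with the metaplectic representation $\omega_\mu$ of $\widetilde P$, whose differential is given by the same operators as above. $\mathrm{Ind}(\mathbb S^*_\mu)$ is the space of smooth $F:\widetilde G\to\mathcal S(\mathbb R)$ with $F(gp)=\omega_\mu(p)^{-1}F(g)$,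 with $\widetilde G$ acting by left translation. **Theorem.** 1. For every $\mu\in\mathbb C$ the pairing $(\cdot,\cdot)$ identifies the restricted dual $\mathfrak p$-module of $\mathbb S_\mu$ with $\mathbb S^*_{-\mu}$. 2. $X_s\mathbb S$ consists of singular vectors for $\hat\pi_{3/4}$; the map $v\mapsto X_s(1\otimes v)$ is injective and $\mathfrak p$-equivariant from $\mathbb S_{-9/4}$ to $(\mathbb C[x,y]\otimes\mathbb S,\hat\pi_{3/4})\simeq M(\mathbb S_{-3/4})$. 3. This singular vector corresponds to $D_s$. Namely, $\langle\hat\pi_\lambda(Z)T,\varphi\rangle=-\langle T,\pi^*_{-\lambda}(Z)\varphi\rangle$ for all $\lambda\in\mathbb C$ and $Z\in\mathfrak{sl}(3,\mathbb C)$; the associated homomorphism of generalized Verma modules $M(\mathbb S_{-9/4})\to M(\mathbb S_{-3/4})$ is $X_s$, i.e. $X_s\hat\pi_{-3/4}(Z)=\hat\pi_{3/4}(Z)X_s$ for all $Z$; and $\langle X_sT,\varphi\rangle=i\langle T,D_s\varphi\rangle$ for all $T,\varphi$. 4. There is exactly one $\widetilde G$-equivariant linear operator $D:\mathrm{Ind}(\mathbb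 S^*_{3/4})\to\mathrm{Ind}(\mathbb S^*_{9/4})$ which in the non-compact picture $F\mapsto\big((\hat x,\hat y)\mapsto F(\exp(\hat xf_1+\hat yf_2))\big)$ is the symplectic Dirac operator $iq\partial_{\hat y}-\partial_{\hat x}\partial_q$. It is a differential operator of order at most $1$ on $\widetilde G/\widetilde P$. It corresponds to the singular vector: for $v\in\mathbb S$ and $F\in\mathrm{Ind}(\mathbb S^*_{3/4})$ one has $\langle X_s(1\otimes v),F\rangle=i\,(v,(DF)(1))$, where $\langle x^ay^b\otimes p,F\rangle=(-1)^{a+b}\big(p,(R(f_1)^aR(f_2)^bF)(1)\big)$ and $R(X)F(g)=\tfrac{d}{dt}F(g\exp tX)|_{t=0}$. 5. On $C^\infty(\bar{\mathfrak u}(\mathbb R),\mathbb S^*)$ one has $D_s\,\pi^*_{-3/4}(X)=\pi^*_{3/4}(X)\,D_s$ for all $X\in\mathfrak{sl}(3,\mathbb R)$. -/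

import Mathlib

open Polynomial TensorProduct SchwartzMap Topology Filter
open scoped ContDiff

noncomputable section

namespace SympDirac

/-! ## The Lie algebra `sl(3)` and its parabolic subalgebra -/

/-- `sl(3, 𝕜)`: the matrices of trace zero. -/
abbrev sl3 (𝕜 : Type) [CommRing 𝕜] : Submodule 𝕜 (Matrix (Fin 3) (Fin 3) 𝕜) :=
  LinearMap.ker (Matrix.traceLinearMap (Fin 3) 𝕜 𝕜)

theorem mem_sl3 {𝕜 : Type} [CommRing 𝕜] {X : Matrix (Fin 3) (Fin 3) 𝕜} :
    X ∈ sl3 𝕜 ↔ X.trace = 0 := LinearMap.mem_ker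

/-- The maximal parabolic subalgebra `𝔭` of `sl(3, 𝕜)` stabilizing the line spanned by the first
basis vector. -/
def parabolic (𝕜 : Type) [CommRing 𝕜] : Submodule 𝕜 (sl3 𝕜) where
  carrier := {X | (X : Matrix (Fin 3) (Fin 3) 𝕜) 1 0 = 0 ∧ (X : Matrix (Fin 3) (Fin 3) 𝕜) 2 0 = 0}
  add_mem' := by
    rintro X Y ⟨h1, h2⟩ ⟨h3, h4⟩
    simp [h1, h2, h3, h4]
  zero_mem' := by simp
  smul_mem' := by
    rintro c X ⟨h1, h2⟩
    simp [h1, h2]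

/-- The nilradical `𝔲` of `𝔭`: matrices whose only nonzero entries are those with (zero-based)
indices `(0, 1)` and `(0, 2)`. -/
def nilradical (𝕜 : Type) [CommRing 𝕜] : Submodule 𝕜 (sl3 𝕜) where
  carrier := {X | ∀ i j, (X : Matrix (Fin 3) (Fin 3) 𝕜) i j ≠ 0 → i = 0 ∧ j ≠ 0}
  add_mem' := by
    intro X Y hX hY i j h
    by_cases h1 : (X : Matrix (Fin 3) (Fin 3) 𝕜) i j = 0
    · by_cases h2 : (Y : Matrix (Fin 3) (Fin 3) 𝕜) i j = 0
      · simp [h1, h2] at h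
      · exact hY i j h2
    · exact hX i j h1
  zero_mem' := by simp
  smul_mem' := by
    intro c X hX i j h
    refine hX i j fun h1 => h ?_
    simp [h1]

/-- The elements `e₁, e₂` (basis of the nilradical), `f₁, f₂` (basis of the opposite nilradical)
and `h₀, e, h, f` (basis of the Levi subalgebra) of `sl(3, ℝ)`. -/
def e₁ : sl3 ℝ := ⟨!![0, 1, 0; 0, 0, 0; 0, 0, 0], mem_sl3.2 (by simp [Matrix.trace_fin_three])⟩
def e₂ : sl3 ℝ := ⟨!![0, 0, 1; 0, 0, 0; 0, 0, 0], mem_sl3.2 (by simp [Matrix.trace_fin_three])⟩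
def f₁ : sl3 ℝ := ⟨!![0, 0, 0; 1, 0, 0; 0, 0, 0], mem_sl3.2 (by simp [Matrix.trace_fin_three])⟩
def f₂ : sl3 ℝ := ⟨!![0, 0, 0; 0, 0, 0; 1, 0, 0], mem_sl3.2 (by simp [Matrix.trace_fin_three])⟩
def eL : sl3 ℝ := ⟨!![0, 0, 0; 0, 0, 1; 0, 0, 0], mem_sl3.2 (by simp [Matrix.trace_fin_three])⟩
def hL : sl3 ℝ := ⟨!![0, 0, 0; 0, 1, 0; 0, 0, -1], mem_sl3.2 (by simp [Matrix.trace_fin_three])⟩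
def fL : sl3 ℝ := ⟨!![0, 0, 0; 0, 0, 0; 0, 1, 0], mem_sl3.2 (by simp [Matrix.trace_fin_three])⟩
def h₀ : sl3 ℝ :=
  ⟨!![1, 0, 0; 0, -1 / 2, 0; 0, 0, -1 / 2], mem_sl3.2 (by simp [Matrix.trace_fin_three]; norm_num)⟩

/-- The inclusion of `sl(3, ℝ)` in its complexification, as complex matrices. -/
def complexify (X : sl3 ℝ) : Matrix (Fin 3) (Fin 3) ℂ :=
  (X : Matrix (Fin 3) (Fin 3) ℝ).map (algebraMap ℝ ℂ)

/-! ## Metaplectic modules and their twists, in an arbitrary operator algebra -/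

/-- Three operators by which the basis `e, h, f` of the semisimple part `𝔩ˢ ≃ sl(2)` of the Levi
subalgebra acts. -/
structure LeviTriple (R : Type) where
  e : R
  h : R
  f : R

/-- The (Segal-Shale-Weil) metaplectic module `𝕊`: the operators are built from `q` and
`dq = ∂_q`. -/
def metaplectic {R : Type} [Ring R] [Algebra ℂ R] (q dq : R) : LeviTriple R where
  e := (Complex.I / 2) • (dq * dq)
  h := -(q * dq) - algebraMap ℂ R (1 / 2)
  f := (Complex.I / 2) • (q * q)

/-- The dual metaplectic module `𝕊*`. -/
def dualMetaplectic {R : Type} [Ring R] [Algebra ℂ R] (q dq : R) : LeviTriple R where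
  e := -(Complex.I / 2) • (q * q)
  h := q * dq + algebraMap ℂ R (1 / 2)
  f := -(Complex.I / 2) • (dq * dq)

/-- The action of an element `Y` of the parabolic subalgebra on the module with twist `μ ω̃₁`
(extended trivially to `h₀` before the twist, and trivially to the nilradical). The matrix `Y` may
have entries in the operator algebra (that is, its entries may be functions); the element
`diag(1, -1/2, -1/2) a + e b + h c + f d` acts by `μ a + b e + c h + d f`. -/
def fiberAction {R : Type} [Ring R] [Algebra ℂ R] (s : LeviTriple R) (μ : ℂ)
    (Y : Matrix (Fin 3) (Fin 3) R) : R :=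
  μ • Y 0 0 + (Y 1 2 * s.e + ((1 / 2 : ℂ) • (Y 1 1 - Y 2 2)) * s.h + Y 2 1 * s.f)

/-- The coefficient `3/2` of `ρ = (3/2) ω̃₁`, half the trace of the adjoint action on `𝔲`. -/
def rho : ℂ := 3 / 2

/-- The infinitesimal action of `X ∈ sl(3)` on sections of the homogeneous bundle induced from the
`𝔭`-module `s` with twist `(lam + ρ) ω̃₁`, in the non-compact picture: with `u = x f₁ + y f₂` and
`Y(u) = exp(-u) X exp(u) = (1 - u) X (1 + u)`, the section `φ` is sent to
`-(Y₁₀ ∂_x + Y₂₀ ∂_y) φ + (action of the 𝔭-component of Y on the fibre) φ`, since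
`exp(-tX) exp(u) = exp(u) exp(-t Y(u))`.
Here `x, y, dx, dy` are the four generators of the Weyl algebra in two variables. -/
def inducedAction {R : Type} [Ring R] [Algebra ℂ R] (x y dx dy : R) (s : LeviTriple R) (lam : ℂ)
    (X : Matrix (Fin 3) (Fin 3) ℂ) : R :=
  let u : Matrix (Fin 3) (Fin 3) R := !![0, 0, 0; x, 0, 0; y, 0, 0]
  let Y : Matrix (Fin 3) (Fin 3) R := (1 - u) * X.map (algebraMap ℂ R) * (1 + u)
  fiberAction s (lam + rho) Y - (Y 1 0 * dx + Y 2 0 * dy)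

/-! ## The modules `𝕊 = ℂ[q]` and `𝕊*` of the parabolic subalgebra -/

/-- Multiplication by `q` and the derivative `∂_q` on `ℂ[q]`. -/
def mulq : Module.End ℂ ℂ[X] := LinearMap.mulLeft ℂ (X : ℂ[X])
def derq : Module.End ℂ ℂ[X] := Polynomial.derivative

/-- The twisted module `𝕊_μ`, `μ` standing for `μ ω̃₁`. -/
def sigma (μ : ℂ) (Z : Matrix (Fin 3) (Fin 3) ℂ) : Module.End ℂ ℂ[X] :=
  fiberAction (metaplectic mulq derq) μ (Z.map (algebraMap ℂ (Module.End ℂ ℂ[X])))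

/-- The twisted dual module `𝕊*_μ`. -/
def sigmaDual (μ : ℂ) (Z : Matrix (Fin 3) (Fin 3) ℂ) : Module.End ℂ ℂ[X] :=
  fiberAction (dualMetaplectic mulq derq) μ (Z.map (algebraMap ℂ (Module.End ℂ ℂ[X])))

/-- The pairing `(p, r) = p(∂_q) r |_{q = 0}` on `𝕊 × 𝕊*`. -/
def spinPairing : ℂ[X] →ₗ[ℂ] ℂ[X] →ₗ[ℂ] ℂ :=
  (LinearMap.compRight ℂ (Polynomial.leval (0 : ℂ))) ∘ₗ (Polynomial.aeval derq).toLinearMap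

/-- The restricted dual of a module `V` with respect to the weight spaces of an operator `h`:
the functionals which vanish on all but finitely many of the weight spaces of `h`. -/
def restrictedDual {V : Type} [AddCommGroup V] [Module ℂ V] (h : Module.End ℂ V) :
    Submodule ℂ (Module.Dual ℂ V) where
  carrier := {ξ | {c : ℂ | ∃ v ∈ h.eigenspace c, ξ v ≠ 0}.Finite}
  add_mem' := by
    intro ξ η hξ hη
    refine (hξ.union hη).subset ?_
    rintro c ⟨v, hv, hc⟩
    by_cases h1 : ξ v = 0
    · exact Or.inr ⟨v, hv, fun h2 => hc (by simp [h1, h2])⟩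
    · exact Or.inl ⟨v, hv, h1⟩
  zero_mem' := by simp
  smul_mem' := by
    intro a ξ hξ
    refine hξ.subset ?_
    rintro c ⟨v, hv, hc⟩
    exact ⟨v, hv, fun h2 => hc (by simp [h2])⟩

/-! ## The generalized Verma module in its Fourier image `ℂ[𝔲̄*] ⊗ 𝕊` -/

/-- `ℂ[𝔲̄*] ⊗ 𝕊`; the variables `x, y` of `ℂ[𝔲̄*]` have index `0, 1`. -/
abbrev VermaSpace : Type := MvPolynomial (Fin 2) ℂ ⊗[ℂ] ℂ[X]

namespace Verma
def mulxy (i : Fin 2) : Module.End ℂ VermaSpace :=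
  (LinearMap.mulLeft ℂ (MvPolynomial.X i : MvPolynomial (Fin 2) ℂ)).rTensor ℂ[X]
def dxy (i : Fin 2) : Module.End ℂ VermaSpace :=
  ((MvPolynomial.pderiv i : Derivation ℂ (MvPolynomial (Fin 2) ℂ) _) :
    MvPolynomial (Fin 2) ℂ →ₗ[ℂ] MvPolynomial (Fin 2) ℂ).rTensor ℂ[X]
def q : Module.End ℂ VermaSpace := mulq.lTensor (MvPolynomial (Fin 2) ℂ)
def dq : Module.End ℂ VermaSpace := derq.lTensor (MvPolynomial (Fin 2) ℂ)
end Verma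

/-- The action `π̂_lam` of `sl(3, ℂ)` on `ℂ[𝔲̄*] ⊗ 𝕊_{lam + ρ}`: the algebraic Fourier transform
`x̂ ↦ -∂_x`, `∂_x̂ ↦ x` (and the same for `y`) of the induced action `π_lam`. -/
def piHat (lam : ℂ) (Z : Matrix (Fin 3) (Fin 3) ℂ) : Module.End ℂ VermaSpace :=
  inducedAction (-Verma.dxy 0) (-Verma.dxy 1) (Verma.mulxy 0) (Verma.mulxy 1)
    (metaplectic Verma.q Verma.dq) lam Z

/-- The space of singular vectors, annihilated by the nilradical. -/
def Sol (lam : ℂ) : Submodule ℂ VermaSpace where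
  carrier := {T | ∀ Z ∈ nilradical ℂ, piHat lam (Z : Matrix (Fin 3) (Fin 3) ℂ) T = 0}
  add_mem' := by
    intro S T hS hT Z hZ
    simp [hS Z hZ, hT Z hZ]
  zero_mem' := by simp
  smul_mem' := by
    intro c T hT Z hZ
    simp [hT Z hZ]

/-- The operator `X_s = y ∂_q + i x q`. -/
def Xs : Module.End ℂ VermaSpace :=
  Verma.mulxy 1 * Verma.dq + Complex.I • (Verma.mulxy 0 * Verma.q)

/-! ## The non-compact picture `C^∞(𝔲̄(ℝ), 𝕊*)` -/

/-- Complex valued smooth functions on `𝔲̄(ℝ) ≃ ℝ²`, with coordinates `(x̂, ŷ)` with respect to the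
basis `f₁, f₂`. -/
def SmoothFun : Subalgebra ℂ (ℝ × ℝ → ℂ) where
  carrier := {g | ContDiff ℝ ∞ g}
  mul_mem' := by
    intro f g hf hg
    rw [Set.mem_ofPred_eq] at hf hg ⊢
    exact ContDiff.mul hf hg
  add_mem' := by
    intro f g hf hg
    rw [Set.mem_ofPred_eq] at hf hg ⊢
    exact ContDiff.add hf hg
  algebraMap_mem' := by
    intro c
    rw [Set.mem_ofPred_eq]
    exact contDiff_const

theorem mem_smoothFun {g : ℝ × ℝ → ℂ} : g ∈ SmoothFun ↔ ContDiff ℝ ∞ g := Iff.rfl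

instance : AddCommGroup SmoothFun := inferInstance
instance : AddCommGroup (SmoothFun ⊗[ℂ] ℂ[X]) := TensorProduct.addCommGroup

/-- The directional derivative in the direction `v`. -/
def dirDeriv (v : ℝ × ℝ) : Module.End ℂ SmoothFun where
  toFun g := ⟨fun u => fderiv ℝ (g : ℝ × ℝ → ℂ) u v,
    mem_smoothFun.2
    ((ContDiff.fderiv_right (m := ∞) (mem_smoothFun.1 g.2) (by simp)).clm_apply contDiff_const)⟩
  map_add' := by
    intro g k
    ext u
    have hg := ((mem_smoothFun.1 g.2).differentiable (by simp)) u
    have hk := ((mem_smoothFun.1 k.2).differentiable (by simp)) u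
    simp [fderiv_add hg hk]
  map_smul' := by
    intro c g
    ext u
    have hg := ((mem_smoothFun.1 g.2).differentiable (by simp)) u
    simp [fderiv_const_smul hg]

/-- The linear coordinate functions `x̂`, `ŷ`. -/
def coordx : SmoothFun := ⟨fun u => (u.1 : ℂ), mem_smoothFun.2
  (Complex.ofRealCLM.contDiff.comp contDiff_fst)⟩
def coordy : SmoothFun := ⟨fun u => (u.2 : ℂ), mem_smoothFun.2
  (Complex.ofRealCLM.contDiff.comp contDiff_snd)⟩

/-- `C^∞(𝔲̄(ℝ), 𝕊*) = C^∞(𝔲̄(ℝ)) ⊗ 𝕊*`. -/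
abbrev Field : Type := SmoothFun ⊗[ℂ] ℂ[X]

namespace Field
def x : Module.End ℂ Field := (LinearMap.mulLeft ℂ coordx).rTensor ℂ[X]
def y : Module.End ℂ Field := (LinearMap.mulLeft ℂ coordy).rTensor ℂ[X]
def dx : Module.End ℂ Field := (dirDeriv (1, 0)).rTensor ℂ[X]
def dy : Module.End ℂ Field := (dirDeriv (0, 1)).rTensor ℂ[X]
def q : Module.End ℂ Field := mulq.lTensor SmoothFun
def dq : Module.End ℂ Field := derq.lTensor SmoothFun
end Field

/-- The action `π*_lam` of `sl(3)` on `C^∞(𝔲̄(ℝ), 𝕊*_{lam + ρ})`. -/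
def piDual (lam : ℂ) (Z : Matrix (Fin 3) (Fin 3) ℂ) : Module.End ℂ Field :=
  inducedAction Field.x Field.y Field.dx Field.dy (dualMetaplectic Field.q Field.dq) lam Z

/-- The symplectic Dirac operator `i q ∂_ŷ - ∂_x̂ ∂_q`. -/
def Ds : Module.End ℂ Field :=
  Complex.I • (Field.q * Field.dy) - Field.dx * Field.dq

/-- The pairing of `ℂ[𝔲̄*]` with smooth functions: a polynomial `P(x, y)` is the Fourier transform of
the distribution `P(∂_x̂, ∂_ŷ) δ`, so that `⟨P, g⟩ = (P(-∂_x̂, -∂_ŷ) g)(0)`. -/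
def deltaPairing : MvPolynomial (Fin 2) ℂ →ₗ[ℂ] SmoothFun →ₗ[ℂ] ℂ :=
  (MvPolynomial.basisMonomials (Fin 2) ℂ).constr ℂ fun m =>
    (-1 : ℂ) ^ (m 0 + m 1) •
      ((LinearMap.proj (0 : ℝ × ℝ)) ∘ₗ SmoothFun.val.toLinearMap ∘ₗ
        ((dirDeriv (1, 0)) ^ (m 0) * (dirDeriv (0, 1)) ^ (m 1) : Module.End ℂ SmoothFun))

/-- The pairing of (Fourier transforms of) `𝕊`-valued distributions supported at the origin with
`𝕊*`-valued smooth functions. -/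
def distPairing : VermaSpace →ₗ[ℂ] Field →ₗ[ℂ] ℂ :=
  (TensorProduct.map₂ deltaPairing spinPairing).compr₂ (LinearMap.mul' ℂ ℂ)

/-! ## The group `S̃L(3, ℝ)` -/

/-- `SL(3, ℝ)`. -/
abbrev SL3 : Type := Matrix.SpecialLinearGroup (Fin 3) ℝ

/-- The group of paths in `SL(3, ℝ)` starting at the identity, with pointwise multiplication. -/
def pathGroup : Subgroup C(unitInterval, SL3) where
  carrier := {γ | γ 0 = 1}
  mul_mem' := by
    intro a b ha hb
    simp only [Set.mem_ofPred_eq] at ha hb ⊢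
    simp [ha, hb]
  one_mem' := rfl
  inv_mem' := by
    intro a ha
    simp only [Set.mem_ofPred_eq] at ha ⊢
    simp [ha]

theorem homotopicRel_mul {a b c d : C(unitInterval, SL3)} {S : Set unitInterval}
    (h₁ : a.HomotopicRel b S) (h₂ : c.HomotopicRel d S) : (a * c).HomotopicRel (b * d) S := by
  obtain ⟨F⟩ := h₁
  obtain ⟨G⟩ := h₂
  exact ⟨{ toFun := fun p => F p * G p
           continuous_toFun := F.continuous.mul G.continuous
           map_zero_left := by intro x; simp
           map_one_left := by intro x; simp
           prop' := by
            intro t x hx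
            have h1 := F.prop' t x hx
            have h2 := G.prop' t x hx
            simp only [ContinuousMap.coe_mk] at h1 h2 ⊢
            have h1' : F (t, x) = a x := h1
            have h2' : G (t, x) = c x := h2
            simp [h1', h2'] }⟩

/-- The subgroup of null-homotopic loops. -/
def nullLoops : Subgroup pathGroup where
  carrier := {γ | (γ : C(unitInterval, SL3)).HomotopicRel 1 {0, 1}}
  mul_mem' := by
    intro a b ha hb
    have := homotopicRel_mul ha hb
    simpa using this
  one_mem' := ContinuousMap.HomotopicRel.refl _
  inv_mem' := by
    intro a ha
    have h := homotopicRel_mul (ContinuousMap.HomotopicRel.refl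
      ((a : C(unitInterval, SL3))⁻¹) (S := {0, 1})) ha
    rw [inv_mul_cancel, mul_one] at h
    exact h.symm

instance : nullLoops.Normal where
  conj_mem := by
    intro a ha g
    have h := homotopicRel_mul (homotopicRel_mul (ContinuousMap.HomotopicRel.refl
      (g : C(unitInterval, SL3)) (S := {0, 1})) ha) (ContinuousMap.HomotopicRel.refl
      ((g : C(unitInterval, SL3))⁻¹) (S := {0, 1}))
    rw [mul_one, mul_inv_cancel] at h
    exact h

/-- The universal (double) cover `G̃ = S̃L(3, ℝ)`: homotopy classes, relative to the end points, of
paths in `SL(3, ℝ)` starting at the identity. It carries the quotient topology. -/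
abbrev Gt : Type := pathGroup ⧸ nullLoops

instance : IsTopologicalGroup C(unitInterval, SL3) where
  continuous_mul := continuous_mul
  continuous_inv := ContinuousMap.continuous_postcomp ⟨fun g : SL3 => g⁻¹, continuous_inv⟩

/-- The covering map `S̃L(3, ℝ) → SL(3, ℝ)`, sending a path to its end point. -/
def proj : Gt →* SL3 :=
  QuotientGroup.lift nullLoops
    { toFun := fun γ => (γ : C(unitInterval, SL3)) 1
      map_one' := rfl
      map_mul' := fun _ _ => rfl }
    (by
      intro γ hγ
      exact hγ.fst_eq_snd (by simp))

open NormedSpace in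
theorem det_exp_eq_one (X : sl3 ℝ) : (exp (X : Matrix (Fin 3) (Fin 3) ℝ)).det = 1 := by
  let _ : NormedRing (Matrix (Fin 3) (Fin 3) ℝ) := Matrix.linftyOpNormedRing
  let _ : NormedAlgebra ℝ (Matrix (Fin 3) (Fin 3) ℝ) := Matrix.linftyOpNormedAlgebra
  change (exp X.1).det = 1
  set A : Matrix (Fin 3) (Fin 3) ℝ := X.1 with hA
  have htr : A 0 0 + A 1 1 + A 2 2 = 0 := by
    rw [← Matrix.trace_fin_three]; exact mem_sl3.1 X.2
  have hM : ∀ t : ℝ, HasDerivAt (fun t : ℝ => exp (t • A)) (exp (t • A) * A) t := fun t =>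
    hasDerivAt_exp_smul_const A t
  have hent : ∀ (t : ℝ) (i j : Fin 3),
      HasDerivAt (fun t : ℝ => exp (t • A) i j) ((exp (t • A) * A) i j) t := by
    intro t i j
    have h1 := ((Matrix.entryLinearMap ℝ ℝ i j).toContinuousLinearMap).hasFDerivAt
      |>.comp_hasDerivAt t (hM t)
    exact h1
  have hder : ∀ t : ℝ, HasDerivAt (fun t : ℝ => (exp (t • A)).det) 0 t := by
    intro t
    simp only [Matrix.det_fin_three]
    have h := fun i j => hent t i j
    refine ((((((((h 0 0).mul (h 1 1)).mul (h 2 2)).sub (((h 0 0).mul (h 1 2)).mul (h 2 1))).sub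
      (((h 0 1).mul (h 1 0)).mul (h 2 2))).add (((h 0 1).mul (h 1 2)).mul (h 2 0))).add
      (((h 0 2).mul (h 1 0)).mul (h 2 1))).sub (((h 0 2).mul (h 1 1)).mul (h 2 0))).congr_deriv ?_
    have h2 : A 2 2 = -A 0 0 - A 1 1 := by linarith
    simp only [Matrix.mul_apply, Fin.sum_univ_three, h2]
    simp only [Pi.mul_apply]
    ring
  have hc := is_const_of_deriv_eq_zero (f := fun t : ℝ => (exp (t • A)).det)
    (fun t => (hder t).differentiableAt) (fun t => (hder t).deriv) 1 0
  simpa using hc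

open NormedSpace in
theorem continuous_exp_smul (X : sl3 ℝ) :
    Continuous fun t : ℝ => exp (t • (X : Matrix (Fin 3) (Fin 3) ℝ)) := by
  let _ : NormedRing (Matrix (Fin 3) (Fin 3) ℝ) := Matrix.linftyOpNormedRing
  let _ : NormedAlgebra ℝ (Matrix (Fin 3) (Fin 3) ℝ) := Matrix.linftyOpNormedAlgebra
  exact continuous_iff_continuousAt.2 fun t =>
    (hasDerivAt_exp_smul_const (X : Matrix (Fin 3) (Fin 3) ℝ) t).continuousAt

/-- The exponential map of `SL(3, ℝ)`. -/
def expSL (X : sl3 ℝ) : SL3 :=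
  ⟨NormedSpace.exp (X : Matrix (Fin 3) (Fin 3) ℝ), det_exp_eq_one X⟩

/-- The path `t ↦ exp(t X)`, `0 ≤ t ≤ 1`. -/
def expPath (X : sl3 ℝ) : pathGroup :=
  ⟨⟨fun t => expSL ((t : ℝ) • X),
    Continuous.subtype_mk ((continuous_exp_smul X).comp continuous_subtype_val) _⟩, by
    rw [← SetLike.mem_coe]
    change expSL (((0 : unitInterval) : ℝ) • X) = 1
    apply Subtype.ext
    simp [expSL]⟩

/-- The exponential map of `S̃L(3, ℝ)`. -/
def expT (X : sl3 ℝ) : Gt := QuotientGroup.mk (expPath X)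

theorem proj_expT (X : sl3 ℝ) : proj (expT X) = expSL X := by
  change expSL (((1 : unitInterval) : ℝ) • X) = expSL X
  simp

/-- The parabolic subgroup `P̃` of `S̃L(3, ℝ)`: the stabilizer of the ray spanned by the first basis
vector, for the action on the sphere `S²` of rays in `ℝ³`, that is, on the double cover of `ℝℙ²`. -/
def Pt : Subgroup Gt where
  carrier := {g | ∃ a : ℝ, 0 < a ∧
    (proj g : Matrix (Fin 3) (Fin 3) ℝ).mulVec ![1, 0, 0] = a • ![1, 0, 0]}
  mul_mem' := by
    rintro g h ⟨a, ha, hga⟩ ⟨b, hb, hhb⟩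
    refine ⟨a * b, mul_pos ha hb, ?_⟩
    rw [map_mul, Matrix.SpecialLinearGroup.coe_mul, ← Matrix.mulVec_mulVec, hhb,
      Matrix.mulVec_smul, hga, smul_smul, mul_comm]
  one_mem' := ⟨1, one_pos, by simp⟩
  inv_mem' := by
    rintro g ⟨a, ha, hga⟩
    refine ⟨a⁻¹, inv_pos.2 ha, ?_⟩
    have h1 : (proj g⁻¹ : Matrix (Fin 3) (Fin 3) ℝ) * (proj g : Matrix (Fin 3) (Fin 3) ℝ) = 1 := by
      rw [← Matrix.SpecialLinearGroup.coe_mul, ← map_mul]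
      simp
    have h2 := congrArg (fun v => (proj g⁻¹ : Matrix (Fin 3) (Fin 3) ℝ).mulVec v) hga
    simp only [Matrix.mulVec_mulVec, h1, Matrix.one_mulVec, Matrix.mulVec_smul] at h2
    rw [h2, smul_smul, inv_mul_cancel₀ ha.ne', one_smul, ← h2]

open NormedSpace in
theorem expT_mem_Pt {X : sl3 ℝ} (hX : X ∈ parabolic ℝ) : expT X ∈ Pt := by
  have key : ∀ Z : sl3 ℝ, Z ∈ parabolic ℝ →
      exp (Z : Matrix (Fin 3) (Fin 3) ℝ) 1 0 = 0 ∧ exp (Z : Matrix (Fin 3) (Fin 3) ℝ) 2 0 = 0 := by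
    rintro Z ⟨h1, h2⟩
    have hb : (Z : Matrix (Fin 3) (Fin 3) ℝ).BlockTriangular (![0, 1, 1] : Fin 3 → ℕ) := by
      intro i j hij
      fin_cases i <;> fin_cases j <;> simp_all
    exact ⟨hb.exp (by simp), hb.exp (by simp)⟩
  set Y : sl3 ℝ := (1 / 2 : ℝ) • X with hY
  have hYp : Y ∈ parabolic ℝ := Submodule.smul_mem _ _ hX
  have hXY : exp (X : Matrix (Fin 3) (Fin 3) ℝ) =
      exp (Y : Matrix (Fin 3) (Fin 3) ℝ) * exp (Y : Matrix (Fin 3) (Fin 3) ℝ) := by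
    rw [← Matrix.exp_add_of_commute _ _ (Commute.refl _)]
    congr 1
    rw [hY, Submodule.coe_smul, ← add_smul]
    norm_num
  obtain ⟨hx1, hx2⟩ := key X hX
  obtain ⟨hy1, hy2⟩ := key Y hYp
  have h00 : exp (X : Matrix (Fin 3) (Fin 3) ℝ) 0 0 =
      exp (Y : Matrix (Fin 3) (Fin 3) ℝ) 0 0 * exp (Y : Matrix (Fin 3) (Fin 3) ℝ) 0 0 := by
    rw [hXY, Matrix.mul_apply, Fin.sum_univ_three, hy1, hy2]
    ring
  have hne : exp (Y : Matrix (Fin 3) (Fin 3) ℝ) 0 0 ≠ 0 := by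
    intro h0
    have hd := det_exp_eq_one Y
    rw [Matrix.det_fin_three, hy1, hy2, h0] at hd
    norm_num at hd
  refine ⟨exp (X : Matrix (Fin 3) (Fin 3) ℝ) 0 0, ?_, ?_⟩
  · rw [h00]
    exact mul_self_pos.2 hne
  · rw [proj_expT]
    ext i
    fin_cases i <;> simp [expSL, Matrix.mulVec, dotProduct, Fin.sum_univ_three, hx1, hx2]

/-! ## The metaplectic representation on Schwartz functions -/

/-- The Schwartz space `𝓢(ℝ)` of functions of `q`. -/
abbrev Schw : Type := 𝓢(ℝ, ℂ)

/-- Multiplication by `q` and the derivative `∂_q` on the Schwartz space. -/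
def schwMulq : Schw →L[ℂ] Schw := SchwartzMap.smulLeftCLM ℂ (fun q : ℝ => (q : ℂ))
def schwDerq : Schw →L[ℂ] Schw := SchwartzMap.derivCLM ℂ ℂ

theorem schwMulq_apply (φ : Schw) (q : ℝ) : schwMulq φ q = q * φ q := by
  rw [schwMulq, SchwartzMap.smulLeftCLM_apply_apply Function.Complex.hasTemperateGrowth_ofReal, smul_eq_mul]

theorem hasTemperateGrowth_gauss (s : ℝ) :
    (fun q : ℝ => Complex.exp (Complex.I * (s * q ^ 2 : ℝ))).HasTemperateGrowth := by
  have h1 : (fun x : ℝ => Complex.exp (Complex.I * x)).HasTemperateGrowth := by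
    have hfun : (fun x : ℝ => Complex.exp (Complex.I * x)) =
        (fun z : ℂ => Complex.exp (Complex.I * z)) ∘ Complex.ofReal := rfl
    have hd : ∀ n : ℕ, iteratedDeriv n (fun x : ℝ => Complex.exp (Complex.I * x)) =
        fun x : ℝ => Complex.I ^ n * Complex.exp (Complex.I * x) := by
      intro n
      induction n with
      | zero => simp
      | succ n ih =>
        rw [iteratedDeriv_succ, ih]
        ext x
        have h2 : HasDerivAt (fun x : ℝ => Complex.exp (Complex.I * x))
            (Complex.exp (Complex.I * x) * (Complex.I * 1)) x :=
          ((Complex.ofRealCLM.hasDerivAt (x := x)).const_mul Complex.I).cexp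
        rw [(h2.const_mul _).deriv]
        ring
    refine ⟨?_, fun n => ⟨0, 1, fun x => ?_⟩⟩
    · exact (contDiff_const.mul Complex.ofRealCLM.contDiff).cexp
    · rw [norm_iteratedFDeriv_eq_norm_iteratedDeriv, hd]
      simp [mul_comm Complex.I, Complex.norm_exp_ofReal_mul_I]
  have h3 : (fun q : ℝ => s * q ^ 2).HasTemperateGrowth :=
    (Function.HasTemperateGrowth.const s).mul (Function.HasTemperateGrowth.id'.pow 2)
  exact h1.comp h3

/-- The unitary operator by which `exp(t e)` acts, `φ ↦ e^{-i t q² / 2} φ`. -/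
def opE (t : ℝ) : Schw →L[ℂ] Schw :=
  SchwartzMap.smulLeftCLM ℂ (fun q : ℝ => Complex.exp (Complex.I * ((-t / 2) * q ^ 2 : ℝ)))

theorem opE_apply (t : ℝ) (φ : Schw) (q : ℝ) :
    opE t φ q = Complex.exp (Complex.I * ((-t / 2) * q ^ 2 : ℝ)) * φ q := by
  rw [opE, SchwartzMap.smulLeftCLM_apply_apply (hasTemperateGrowth_gauss _), smul_eq_mul]

/-- The unitary operator by which `exp(t h)` acts, `φ ↦ e^{t / 2} φ(e^t q)`. -/
def opH (t : ℝ) : Schw →L[ℂ] Schw :=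
  (Real.exp (t / 2) : ℂ) • SchwartzMap.compCLMOfContinuousLinearEquiv ℂ
    (ContinuousLinearEquiv.unitsEquivAut ℝ (Units.mk0 (Real.exp t) (Real.exp_pos t).ne'))

theorem opH_apply (t : ℝ) (φ : Schw) (q : ℝ) :
    opH t φ q = (Real.exp (t / 2) : ℂ) * φ (q * Real.exp t) := by
  simp [opH]

/-- The unitary operator by which `exp(t f)` acts, `exp(-(i t / 2) ∂_q²)`: the Fourier multiplier
with symbol `exp(2 π² i t ξ²)`, the Fourier transform being `∫ e^{-2 π i q ξ} φ(q) dq`. -/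
def opF (t : ℝ) : Schw →L[ℂ] Schw :=
  SchwartzMap.fourierMultiplierCLM ℂ
    (fun ξ : ℝ => Complex.exp (Complex.I * ((2 * Real.pi ^ 2 * t) * ξ ^ 2 : ℝ)))

/-- The one-parameter subgroups of `P̃` generating it, together with the operators by which they act
in the dual metaplectic representation with twist `μ ω̃₁` on the Schwartz space. Their derivatives
are the operators of `dualMetaplectic q ∂_q` for `e, h, f`, the scalar `μ` for `h₀`, and `0` for the
nilradical. -/
inductive MetaplecticGenerator (μ : ℝ) : Pt → (Schw →L[ℂ] Schw) → Prop
  | e (t : ℝ) (p : Pt) : (p : Gt) = expT (t • eL) → MetaplecticGenerator μ p (opE t)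
  | h (t : ℝ) (p : Pt) : (p : Gt) = expT (t • hL) → MetaplecticGenerator μ p (opH t)
  | f (t : ℝ) (p : Pt) : (p : Gt) = expT (t • fL) → MetaplecticGenerator μ p (opF t)
  | h₀ (t : ℝ) (p : Pt) : (p : Gt) = expT (t • h₀) →
      MetaplecticGenerator μ p ((Real.exp (μ * t) : ℂ) • ContinuousLinearMap.id ℂ Schw)
  | u (t s : ℝ) (p : Pt) : (p : Gt) = expT (t • e₁ + s • e₂) →
      MetaplecticGenerator μ p (ContinuousLinearMap.id ℂ Schw)

/-- The graph of the dual metaplectic representation `P̃ → GL(𝓢(ℝ))` twisted by the character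
`μ ω̃₁`: the submonoid of `P̃ × End(𝓢(ℝ))` generated by the one-parameter groups above (it is closed
under inverses, since each one-parameter group is). As `P̃` is connected, these generate `P̃`. -/
def metaplecticGraph (μ : ℝ) : Submonoid (Pt × (Schw →L[ℂ] Schw)) :=
  Submonoid.closure {pT | MetaplecticGenerator μ pT.1 pT.2}

/-! ## Smooth functions on `S̃L(3, ℝ)` and principal series -/

/-- `v` is the derivative at `0` of the curve `c` in the Schwartz space (with its Fréchet
topology). -/
def HasVelocity (c : ℝ → Schw) (v : Schw) : Prop :=
  Tendsto (fun t : ℝ => t⁻¹ • (c t - c 0)) (𝓝[≠] 0) (𝓝 v)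

/-- Functions of class `C^n` from `S̃L(3, ℝ)` to the Schwartz space: continuous functions which, if
`n > 0`, have derivatives `R(X) F (g) = d/dt F(g exp(tX)) |_{t = 0}`, linear in `X ∈ sl(3, ℝ)`, which
are of class `C^(n - 1)`. -/
def IsCk : ℕ → (Gt → Schw) → Prop
  | 0, F => Continuous F
  | n + 1, F => Continuous F ∧ ∃ F' : sl3 ℝ →ₗ[ℝ] (Gt → Schw),
      (∀ X g, HasVelocity (fun t => F (g * expT (t • X))) (F' X g)) ∧ ∀ X, IsCk n (F' X)

theorem HasVelocity.add {c d : ℝ → Schw} {v w : Schw} (h : HasVelocity c v)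
    (k : HasVelocity d w) : HasVelocity (fun t => c t + d t) (v + w) := by
  refine (Tendsto.add h k).congr fun t => ?_
  rw [← smul_add, add_sub_add_comm]

theorem HasVelocity.map {c : ℝ → Schw} {v : Schw} (h : HasVelocity c v) (a : ℂ) :
    HasVelocity (fun t => a • c t) (a • v) := by
  refine (Tendsto.const_smul h a).congr fun t => ?_
  rw [smul_comm, smul_sub]

theorem HasVelocity.unique {c : ℝ → Schw} {v w : Schw} (h : HasVelocity c v)
    (k : HasVelocity c w) : v = w := tendsto_nhds_unique h k

theorem IsCk.add {n : ℕ} : ∀ {F K : Gt → Schw}, IsCk n F → IsCk n K → IsCk n (F + K) := by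
  induction n with
  | zero => exact fun hF hK => Continuous.add hF hK
  | succ n ih =>
    rintro F K ⟨hF, F', hF', hF''⟩ ⟨hK, K', hK', hK''⟩
    exact ⟨hF.add hK, F' + K', fun X g => (hF' X g).add (hK' X g),
      fun X => ih (hF'' X) (hK'' X)⟩

theorem IsCk.smul {n : ℕ} (a : ℂ) : ∀ {F : Gt → Schw}, IsCk n F → IsCk n (a • F) := by
  induction n with
  | zero => exact fun hF => Continuous.const_smul hF a
  | succ n ih =>
    rintro F ⟨hF, F', hF', hF''⟩
    exact ⟨hF.const_smul a, a • F', fun X g => (hF' X g).map a, fun X => ih (hF'' X)⟩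

theorem IsCk.zero {n : ℕ} : IsCk n (0 : Gt → Schw) := by
  induction n with
  | zero => exact continuous_const
  | succ n ih =>
    exact ⟨continuous_const, 0, fun X g => by simp [HasVelocity], fun X => ih⟩

theorem IsCk.translate {n : ℕ} (k : Gt) :
    ∀ {F : Gt → Schw}, IsCk n F → IsCk n (fun g => F (k * g)) := by
  induction n with
  | zero => exact fun hF => Continuous.comp hF (continuous_const_mul k)
  | succ n ih =>
    rintro F ⟨hF, F', hF', hF''⟩
    refine ⟨hF.comp (continuous_const_mul k),
      { toFun := fun X g => F' X (k * g)
        map_add' := fun X Y => by ext1 g; simp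
        map_smul' := fun a X => by ext1 g; simp }, fun X g => ?_, fun X => ih (hF'' X)⟩
    have := hF' X (k * g)
    simp only [mul_assoc] at this ⊢
    exact this

/-- `C^∞(S̃L(3, ℝ), 𝓢(ℝ))`. -/
def smoothFunctions : Submodule ℂ (Gt → Schw) where
  carrier := {F | ∀ n, IsCk n F}
  add_mem' := by
    intro F K hF hK
    rw [Set.mem_ofPred_eq] at hF hK ⊢
    exact fun n => (hF n).add (hK n)
  zero_mem' := by
    rw [Set.mem_ofPred_eq]
    exact fun n => IsCk.zero
  smul_mem' := by
    intro a F hF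
    rw [Set.mem_ofPred_eq] at hF ⊢
    exact fun n => (hF n).smul a

theorem mem_smoothFunctions {F : Gt → Schw} : F ∈ smoothFunctions ↔ ∀ n, IsCk n F := Iff.rfl

theorem exists_rightDeriv (X : sl3 ℝ) (F : smoothFunctions) : ∃ K : smoothFunctions,
    ∀ g, HasVelocity (fun t => (F : Gt → Schw) (g * expT (t • X))) ((K : Gt → Schw) g) := by
  obtain ⟨-, F', hF', -⟩ := mem_smoothFunctions.1 F.2 1
  refine ⟨⟨F' X, mem_smoothFunctions.2 fun n => ?_⟩, hF' X⟩
  obtain ⟨-, K', hK', hK''⟩ := mem_smoothFunctions.1 F.2 (n + 1)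
  have : F' X = K' X := funext fun g => (hF' X g).unique (hK' X g)
  rw [this]
  exact hK'' X

/-- The right derivative `(R(X) F)(g) = d/dt F(g exp(tX)) |_{t = 0}` for `X ∈ sl(3, ℝ)`. -/
def rightDeriv (X : sl3 ℝ) : Module.End ℂ smoothFunctions where
  toFun F := (exists_rightDeriv X F).choose
  map_add' := by
    intro F K
    apply Subtype.ext
    funext g
    exact ((exists_rightDeriv X (F + K)).choose_spec g).unique
      (((exists_rightDeriv X F).choose_spec g).add ((exists_rightDeriv X K).choose_spec g))
  map_smul' := by
    intro a F
    apply Subtype.ext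
    funext g
    exact ((exists_rightDeriv X (a • F)).choose_spec g).unique
      (((exists_rightDeriv X F).choose_spec g).map a)

theorem rightDeriv_spec (X : sl3 ℝ) (F : smoothFunctions) (g : Gt) :
    HasVelocity (fun t => (F : Gt → Schw) (g * expT (t • X))) ((rightDeriv X F : Gt → Schw) g) :=
  (exists_rightDeriv X F).choose_spec g

/-- The space of the principal series representation `Ind_{P̃}^{G̃} 𝕊*_μ`, induced from the
dual metaplectic representation `ω_μ` of `P̃` with twist `μ ω̃₁`: smooth functions
`F : G̃ → 𝓢(ℝ)` such that `F(g p) = ω_μ(p)⁻¹ F(g)`, that is, `ω_μ(p) F(g p) = F(g)`. -/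
def principalSeries (μ : ℝ) : Submodule ℂ smoothFunctions where
  carrier := {F | ∀ pT ∈ metaplecticGraph μ, ∀ g : Gt,
    pT.2 ((F : Gt → Schw) (g * pT.1)) = (F : Gt → Schw) g}
  add_mem' := by
    intro F K hF hK
    rw [Set.mem_ofPred_eq] at hF hK ⊢
    intro pT hp g
    simp [hF pT hp g, hK pT hp g]
  zero_mem' := by
    rw [Set.mem_ofPred_eq]
    simp
  smul_mem' := by
    intro a F hF
    rw [Set.mem_ofPred_eq] at hF ⊢
    intro pT hp g
    simp [hF pT hp g]

theorem mem_principalSeries {μ : ℝ} {F : smoothFunctions} : F ∈ principalSeries μ ↔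
    ∀ pT ∈ metaplecticGraph μ, ∀ g : Gt,
      pT.2 ((F : Gt → Schw) (g * pT.1)) = (F : Gt → Schw) g := Iff.rfl

/-- The function on `G̃` underlying an element of the principal series. -/
def sectionFun {μ : ℝ} (F : principalSeries μ) : Gt → Schw := (F : smoothFunctions)

/-- The representation of `G̃` on the principal series by left translations,
`(k · F)(g) = F(k⁻¹ g)`. -/
def principalSeriesRep (μ : ℝ) : Representation ℂ Gt (principalSeries μ) where
  toFun k :=
    { toFun := fun F => ⟨⟨fun g => sectionFun F (k⁻¹ * g), mem_smoothFunctions.2 fun n =>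
          (mem_smoothFunctions.1 F.1.2 n).translate k⁻¹⟩, mem_principalSeries.2 fun pT hp g => by
          have := mem_principalSeries.1 F.2 pT hp (k⁻¹ * g)
          rw [mul_assoc] at this
          exact this⟩
      map_add' := fun F K => rfl
      map_smul' := fun a F => rfl }
  map_one' := by
    apply LinearMap.ext
    intro F
    apply Subtype.ext
    apply Subtype.ext
    funext g
    change sectionFun F (1⁻¹ * g) = sectionFun F g
    simp
  map_mul' := by
    intro k l
    apply LinearMap.ext
    intro F
    apply Subtype.ext
    apply Subtype.ext
    funext g
    change sectionFun F ((k * l)⁻¹ * g) = sectionFun F (l⁻¹ * (k⁻¹ * g))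
    simp [mul_assoc]

/-- A linear operator between principal series is a differential operator of order at most `k` if
its value at `g` depends only on the `k`-jet at `g`. -/
def IsDifferentialOperator {μ ν : ℝ} (k : ℕ) (D : principalSeries μ →ₗ[ℂ] principalSeries ν) :
    Prop :=
  ∀ (F : principalSeries μ) (g : Gt),
    (∀ l : List (sl3 ℝ), l.length ≤ k →
      (((l.map rightDeriv).prod F.1 : smoothFunctions) : Gt → Schw) g = 0) → sectionFun (D F) g = 0

/-- The restriction of a section to the open Schubert cell, `u = (x̂, ŷ) ↦ F(exp(x̂ f₁ + ŷ f₂))`. -/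
def nonCompact {μ : ℝ} (F : principalSeries μ) (x y : ℝ) : Schw := sectionFun F (expT (x • f₁ + y • f₂))

/-- In the non-compact picture, `D` is the operator `i q ∂_ŷ - ∂_x̂ ∂_q` (all the derivatives in
`x̂` and `ŷ` being derivatives of curves in the Schwartz space). -/
def IsSymplecticDirac {μ ν : ℝ} (D : principalSeries μ →ₗ[ℂ] principalSeries ν) : Prop :=
  ∀ (F : principalSeries μ) (x y : ℝ), ∃ φy ψx : Schw,
    HasVelocity (fun t => nonCompact F x (y + t)) φy ∧
    HasVelocity (fun t => schwDerq (nonCompact F (x + t) y)) ψx ∧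
    nonCompact (D F) x y = Complex.I • schwMulq φy - ψx

/-- The pairing `(p, r) = p(∂_q) r |_{q = 0}` of `𝕊 = ℂ[q]` with Schwartz functions. -/
def schwPairing : ℂ[X] →ₗ[ℂ] Schw →ₗ[ℂ] ℂ where
  toFun p :=
    { toFun := fun r => (Polynomial.aeval (schwDerq : Module.End ℂ Schw) p r) 0
      map_add' := fun r s => by simp
      map_smul' := fun a r => by simp }
  map_add' := fun p r => by ext s; simp
  map_smul' := fun a p => by ext s; simp

/-- The duality between the generalized Verma module and smooth functions on `G̃`: since `x, y` act
in the Verma module as `-f₁, -f₂`, one has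
`⟨x^a y^b ⊗ p, F⟩ = (-1)^(a + b) (p, (R(f₁)^a R(f₂)^b F)(1))`. -/
def vermaPairing : VermaSpace →ₗ[ℂ] smoothFunctions →ₗ[ℂ] ℂ :=
  TensorProduct.lift <| (MvPolynomial.basisMonomials (Fin 2) ℂ).constr ℂ fun m =>
    (-1 : ℂ) ^ (m 0 + m 1) •
      (LinearMap.lcomp ℂ ℂ
        ((LinearMap.proj (1 : Gt)) ∘ₗ smoothFunctions.subtype ∘ₗ
          (rightDeriv f₁ ^ (m 0) * rightDeriv f₂ ^ (m 1) : Module.End ℂ smoothFunctions))) ∘ₗ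
      schwPairing

end SympDirac

end

/-! The algebraic statements are all consequences of one identity in the Weyl algebra in `x, y, q`.
Written out in the generators, the induced action is an explicit linear form in the matrix entries,
and normal ordering shows that `i q ∂_y - ∂_x ∂_q` intertwines the dual metaplectic actions with
parameters `-3/4` and `3/4` on traceless matrices (`dirac_mul_inducedAction`). On smooth fields this
is the infinitesimal intertwining property. On the Verma side the substitution `q ↦ i ∂_q`, `∂_q ↦ i
q` respects the Weyl relations, turns the dual metaplectic formulas into the metaplectic ones, and
turns the Dirac operator into `-X_s`; hence `X_s` is a homomorphism of Verma modules. Vectors `1 ⊗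
v` are killed by `∂_x, ∂_y`, so `𝔭` acts on them through `𝕊` with twist `lam - ρ`, and the
nilradical kills them. Their images under `X_s` are therefore singular.

The duality statements reduce to the transposes of the six generators. The only nontrivial ones come
from `[p(∂), q] = p'(∂)` together with the vanishing of the coordinates at the origin. For the
restricted dual, `q^n` spans the `h`-weight space of weight `-n - 1/2`, so a functional supported on
finitely many weights is given by a polynomial.

On the group, the operator is `i q R(f₂) - ∂_q R(f₁)`. Right derivatives commute with left
translations, so equivariance is immediate; what must be proved is that twist `3/4` is carried to
twist `9/4`. This is checked on the generating one-parameter groups of `P̃`. For the Levi factor,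
the adjoint action on `f₁, f₂` compensates the action of the metaplectic operators on `q, ∂_q`, and
`h₀` accounts for the shift by `3/2`. For the nilradical, `Ad(p) f_i - f_i` lies in `𝔭`, where `R`
is determined by the inducing representation (`hasVelocity_rightDeriv`), and the resulting terms
cancel for twist `3/4`. Uniqueness holds because the non-compact formula at the origin fixes the
value at the identity, and equivariance transports it to all of `G̃`. -/

noncomputable section

namespace SympDirac

/-! ## Intertwining in the Weyl algebra -/

/-- The defining relations of the Weyl algebra in three variables `x, y, q`, oriented towards the
normal order `x, y, ∂_x, ∂_y, q, ∂_q`. -/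
structure WeylRelations {R : Type} [Ring R] (x y dx dy q dq : R) : Prop where
  dx_x : dx * x = x * dx + 1
  dy_y : dy * y = y * dy + 1
  dq_q : dq * q = q * dq + 1
  y_x : y * x = x * y
  dx_y : dx * y = y * dx
  dy_x : dy * x = x * dy
  dy_dx : dy * dx = dx * dy
  q_x : q * x = x * q
  q_y : q * y = y * q
  q_dx : q * dx = dx * q
  q_dy : q * dy = dy * q
  dq_x : dq * x = x * dq
  dq_y : dq * y = y * dq
  dq_dx : dq * dx = dx * dq
  dq_dy : dq * dy = dy * dq

theorem mul_mul_eq_of_mul_eq {R : Type} [Ring R] {a b c : R} (h : a * b = c) (z : R) :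
    a * (b * z) = c * z := by
  rw [← mul_assoc, h]

section Weyl

variable {R : Type} [Ring R] [Algebra ℂ R]

/-- The conjugate `(1 - u) X (1 + u)` is at most quadratic in `x, y`; sorting by the entries of `X`
replaces it by explicit differential operators, the form in which every later computation is made.
-/
theorem inducedAction_eq (x y dx dy : R) (s : LeviTriple R) (lam : ℂ)
    (X : Matrix (Fin 3) (Fin 3) ℂ) : inducedAction x y dx dy s lam X =
      X 0 0 • ((lam + rho) • 1 + x * dx + y * dy) +
      X 0 1 • ((lam + rho) • x - (1 / 2 : ℂ) • (x * s.h) - y * s.f + x * x * dx + y * x * dy) +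
      X 0 2 • ((lam + rho) • y - x * s.e + (1 / 2 : ℂ) • (y * s.h) + x * y * dx + y * y * dy) -
      X 1 0 • dx - X 2 0 • dy +
      X 1 1 • ((1 / 2 : ℂ) • s.h - x * dx) - X 2 2 • ((1 / 2 : ℂ) • s.h + y * dy) +
      X 1 2 • (s.e - y * dx) + X 2 1 • (s.f - x * dy) := by
  simp only [inducedAction, fiberAction, Matrix.mul_apply, Fin.sum_univ_three, Matrix.map_apply,
    Matrix.sub_apply, Matrix.add_apply, Matrix.one_apply, Algebra.algebraMap_eq_smul_one]
  simp [add_mul, sub_mul, smul_sub, smul_add, mul_assoc]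
  module

/-- The two modules differ by the symplectic rotation of the plane of `q` and `∂_q`, so results for
one transfer to the other. -/
theorem metaplectic_eq_dualMetaplectic {q dq : R} (h : dq * q = q * dq + 1) :
    metaplectic q dq = dualMetaplectic (Complex.I • dq) (Complex.I • q) := by
  have hI : Complex.I * Complex.I = -1 := Complex.I_mul_I
  simp only [metaplectic, dualMetaplectic, LeviTriple.mk.injEq, smul_mul_smul_comm, hI, h,
    Algebra.algebraMap_eq_smul_one]
  refine ⟨?_, ?_, ?_⟩ <;> module

theorem WeylRelations.rotate {x y dx dy q dq : R} (h : WeylRelations x y dx dy q dq) :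
    WeylRelations x y dx dy (Complex.I • dq) (Complex.I • q) where
  __ := h
  dq_q := by
    rw [smul_mul_smul_comm, smul_mul_smul_comm, h.dq_q, Complex.I_mul_I]
    module
  q_x := by simp [h.dq_x]
  q_y := by simp [h.dq_y]
  q_dx := by simp [h.dq_dx]
  q_dy := by simp [h.dq_dy]
  dq_x := by simp [h.q_x]
  dq_y := by simp [h.q_y]
  dq_dx := by simp [h.q_dx]
  dq_dy := by simp [h.q_dy]

theorem WeylRelations.dirac_mul_inducedAction {x y dx dy q dq : R}
    (h : WeylRelations x y dx dy q dq) {Z : Matrix (Fin 3) (Fin 3) ℂ} (hZ : Z.trace = 0) :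
    (Complex.I • (q * dy) - dx * dq) * inducedAction x y dx dy (dualMetaplectic q dq) (-3 / 4) Z =
      inducedAction x y dx dy (dualMetaplectic q dq) (3 / 4) Z *
        (Complex.I • (q * dy) - dx * dq) := by
  have hI : Complex.I * Complex.I = -1 := Complex.I_mul_I
  -- Tracelessness is essential: the identity matrix would act by the scalars `3/4` on one side and
  -- `9/4` on the other.
  have h22 : Z 2 2 = -Z 0 0 - Z 1 1 := by
    rw [Matrix.trace_fin_three] at hZ
    linear_combination hZ
  rw [inducedAction_eq, inducedAction_eq, h22]
  simp only [dualMetaplectic, rho, Algebra.algebraMap_eq_smul_one, mul_assoc, mul_add, add_mul,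
    mul_sub, sub_mul, smul_mul_assoc, mul_smul_comm, mul_one, one_mul, smul_add, smul_sub,
    smul_smul, h.dq_q, h.y_x, h.q_x, h.q_y, h.q_dx, h.q_dy, h.dq_x, h.dq_y, h.dq_dx, h.dq_dy,
    mul_mul_eq_of_mul_eq h.dx_x, mul_mul_eq_of_mul_eq h.dy_y, mul_mul_eq_of_mul_eq h.dq_q,
    mul_mul_eq_of_mul_eq h.dx_y, mul_mul_eq_of_mul_eq h.dy_x, mul_mul_eq_of_mul_eq h.dy_dx,
    mul_mul_eq_of_mul_eq h.q_x, mul_mul_eq_of_mul_eq h.q_y, mul_mul_eq_of_mul_eq h.q_dx,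
    mul_mul_eq_of_mul_eq h.q_dy, mul_mul_eq_of_mul_eq h.dq_x, mul_mul_eq_of_mul_eq h.dq_y,
    mul_mul_eq_of_mul_eq h.dq_dx, mul_mul_eq_of_mul_eq h.dq_dy]
  -- Both sides are now combinations of normally ordered monomials, so only their scalar
  -- coefficients remain to be compared.
  match_scalars <;> first | ring1 | (ring_nf; simp only [Complex.I_sq]; ring1)

/-- Under a pairing for which the transposes of the generators of the Weyl algebra are given by
`x ↦ x`, `∂_x ↦ -∂_x`, `q ↦ ∂_q`, `∂_q ↦ q`, the induced actions for the metaplectic module and for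
its dual are contragredient to each other. -/
theorem pairing_inducedAction {V W : Type} [AddCommGroup V] [Module ℂ V] [AddCommGroup W]
    [Module ℂ W] (B : V →ₗ[ℂ] W →ₗ[ℂ] ℂ) {x y dx dy q dq : Module.End ℂ V}
    {x' y' dx' dy' q' dq' : Module.End ℂ W} (h : WeylRelations x' y' dx' dy' q' dq')
    (hx : ∀ v w, B (x v) w = B v (x' w)) (hy : ∀ v w, B (y v) w = B v (y' w))
    (hdx : ∀ v w, B (dx v) w = -B v (dx' w)) (hdy : ∀ v w, B (dy v) w = -B v (dy' w))
    (hq : ∀ v w, B (q v) w = B v (dq' w)) (hdq : ∀ v w, B (dq v) w = B v (q' w))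
    (lam : ℂ) {Z : Matrix (Fin 3) (Fin 3) ℂ} (hZ : Z.trace = 0) (v : V) (w : W) :
    B (inducedAction x y dx dy (metaplectic q dq) lam Z v) w =
      -B v (inducedAction x' y' dx' dy' (dualMetaplectic q' dq') (-lam) Z w) := by
  have h22 : Z 2 2 = -Z 0 0 - Z 1 1 := by
    rw [Matrix.trace_fin_three] at hZ
    linear_combination hZ
  have comm {a b : Module.End ℂ W} (hab : a * b = b * a) (u : W) : a (b u) = b (a u) :=
    LinearMap.congr_fun hab u
  have comm_one {a b : Module.End ℂ W} (hab : a * b = b * a + 1) (u : W) :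
      a (b u) = b (a u) + u := LinearMap.congr_fun hab u
  rw [inducedAction_eq, inducedAction_eq, h22]
  simp only [metaplectic, dualMetaplectic, rho, Algebra.algebraMap_eq_smul_one, mul_assoc, mul_add,
    mul_sub, mul_smul_comm, mul_one, smul_add, smul_sub, smul_smul, LinearMap.add_apply,
    LinearMap.sub_apply, LinearMap.smul_apply, LinearMap.neg_apply, Module.End.mul_apply,
    Module.End.one_apply, map_add, map_sub, map_smul, map_neg, mul_neg, smul_neg, neg_smul,
    hx, hy, hdx, hdy, hq, hdq, comm_one h.dx_x, comm_one h.dy_y, comm h.y_x,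
    comm h.dx_y, comm h.dy_x, comm h.q_x, comm h.q_y, comm h.dq_x, comm h.dq_y, smul_eq_mul]
  ring

end Weyl

/-! ## The Weyl algebra acting on polynomials and on smooth functions -/

theorem derq_mul_mulq : derq * mulq = mulq * derq + 1 := by
  refine LinearMap.ext fun p => ?_
  simp [derq, mulq, add_comm]

theorem dirDeriv_comm (v w : ℝ × ℝ) : dirDeriv v * dirDeriv w = dirDeriv w * dirDeriv v := by
  ext g u
  have hg : ContDiff ℝ ∞ (g : ℝ × ℝ → ℂ) := mem_smoothFun.1 g.2
  have hd : DifferentiableAt ℝ (fderiv ℝ (g : ℝ × ℝ → ℂ)) u :=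
    (hg.fderiv_right (m := ∞) (by simp)).differentiable (by simp) u
  have key (a b : ℝ × ℝ) : ((dirDeriv a * dirDeriv b) g : ℝ × ℝ → ℂ) u =
      fderiv ℝ (fderiv ℝ (g : ℝ × ℝ → ℂ)) u a b := by
    change fderiv ℝ (fun z => fderiv ℝ (g : ℝ × ℝ → ℂ) z b) u a = _
    rw [fderiv_clm_apply hd (by fun_prop)]
    simp
  rw [key, key]
  exact (hg.contDiffAt.isSymmSndFDerivAt (by simp; exact WithTop.coe_le_coe.2 le_top)) v w

theorem dirDeriv_mul (v : ℝ × ℝ) (g k : SmoothFun) :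
    dirDeriv v (g * k) = dirDeriv v g * k + g * dirDeriv v k := by
  ext u
  have hg := ((mem_smoothFun.1 g.2).differentiable (by simp)) u
  have hk := ((mem_smoothFun.1 k.2).differentiable (by simp)) u
  change fderiv ℝ ((g : ℝ × ℝ → ℂ) * (k : ℝ × ℝ → ℂ)) u v =
    fderiv ℝ (g : ℝ × ℝ → ℂ) u v * (k : ℝ × ℝ → ℂ) u +
      (g : ℝ × ℝ → ℂ) u * fderiv ℝ (k : ℝ × ℝ → ℂ) u v
  rw [fderiv_mul hg hk]
  simp
  ring

theorem dirDeriv_coordx (v : ℝ × ℝ) : dirDeriv v coordx = algebraMap ℂ SmoothFun v.1 := by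
  ext u
  change fderiv ℝ (Complex.ofRealCLM ∘L ContinuousLinearMap.fst ℝ ℝ ℝ) u v = _
  rw [ContinuousLinearMap.fderiv]
  rfl

theorem dirDeriv_coordy (v : ℝ × ℝ) : dirDeriv v coordy = algebraMap ℂ SmoothFun v.2 := by
  ext u
  change fderiv ℝ (Complex.ofRealCLM ∘L ContinuousLinearMap.snd ℝ ℝ ℝ) u v = _
  rw [ContinuousLinearMap.fderiv]
  rfl

theorem dirDeriv_mul_mulLeft (v : ℝ × ℝ) (g : SmoothFun) :
    dirDeriv v * LinearMap.mulLeft ℂ g =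
      LinearMap.mulLeft ℂ g * dirDeriv v + LinearMap.mulLeft ℂ (dirDeriv v g) := by
  ext1 k
  simp [dirDeriv_mul, add_comm]

theorem dirDeriv_zero_mul_coordx : dirDeriv (1, 0) * LinearMap.mulLeft ℂ coordx =
    LinearMap.mulLeft ℂ coordx * dirDeriv (1, 0) + 1 := by
  rw [dirDeriv_mul_mulLeft, dirDeriv_coordx]
  simp [Module.End.one_eq_id]

theorem dirDeriv_one_mul_coordy : dirDeriv (0, 1) * LinearMap.mulLeft ℂ coordy =
    LinearMap.mulLeft ℂ coordy * dirDeriv (0, 1) + 1 := by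
  rw [dirDeriv_mul_mulLeft, dirDeriv_coordy]
  simp [Module.End.one_eq_id]

theorem dirDeriv_one_mul_coordx : dirDeriv (0, 1) * LinearMap.mulLeft ℂ coordx =
    LinearMap.mulLeft ℂ coordx * dirDeriv (0, 1) := by
  rw [dirDeriv_mul_mulLeft, dirDeriv_coordx]
  simp

theorem dirDeriv_zero_mul_coordy : dirDeriv (1, 0) * LinearMap.mulLeft ℂ coordy =
    LinearMap.mulLeft ℂ coordy * dirDeriv (1, 0) := by
  rw [dirDeriv_mul_mulLeft, dirDeriv_coordy]
  simp

/-- Two commuting representations of Weyl algebras, in two variables on `V` and in one variable on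
`W`, give a representation of the Weyl algebra in three variables on `V ⊗ W`. -/
theorem WeylRelations.tensor {V W : Type} [AddCommGroup V] [Module ℂ V] [AddCommGroup W]
    [Module ℂ W] {x y dx dy : Module.End ℂ V} {q dq : Module.End ℂ W}
    (dx_x : dx * x = x * dx + 1) (dy_y : dy * y = y * dy + 1) (dq_q : dq * q = q * dq + 1)
    (y_x : y * x = x * y) (dx_y : dx * y = y * dx) (dy_x : dy * x = x * dy)
    (dy_dx : dy * dx = dx * dy) :
    WeylRelations (x.rTensor W) (y.rTensor W) (dx.rTensor W) (dy.rTensor W) (q.lTensor V)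
      (dq.lTensor V) := by
  have comm (a : Module.End ℂ W) (b : Module.End ℂ V) :
      a.lTensor V * b.rTensor W = b.rTensor W * a.lTensor V := by
    rw [Module.End.mul_eq_comp, Module.End.mul_eq_comp, LinearMap.lTensor_comp_rTensor,
      LinearMap.rTensor_comp_lTensor]
  have right {a b c d : Module.End ℂ V} (h : a * b = c * d) :
      a.rTensor W * b.rTensor W = c.rTensor W * d.rTensor W := by
    rw [← LinearMap.rTensor_mul, h, LinearMap.rTensor_mul]
  have right_one {a b : Module.End ℂ V} (h : a * b = b * a + 1) :
      a.rTensor W * b.rTensor W = b.rTensor W * a.rTensor W + 1 := by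
    rw [← LinearMap.rTensor_mul, h, LinearMap.rTensor_add, LinearMap.rTensor_mul]
    congr 1
    exact LinearMap.rTensor_id _ _
  have left_one : dq.lTensor V * q.lTensor V = q.lTensor V * dq.lTensor V + 1 := by
    rw [← LinearMap.lTensor_mul, dq_q, LinearMap.lTensor_add, LinearMap.lTensor_mul]
    congr 1
    exact LinearMap.lTensor_id _ _
  exact ⟨right_one dx_x, right_one dy_y, left_one, right y_x, right dx_y, right dy_x, right dy_dx,
    comm _ _, comm _ _, comm _ _, comm _ _, comm _ _, comm _ _, comm _ _, comm _ _⟩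

theorem weylRelations_field :
    WeylRelations Field.x Field.y Field.dx Field.dy Field.q Field.dq := by
  refine .tensor dirDeriv_zero_mul_coordx dirDeriv_one_mul_coordy derq_mul_mulq ?_
    dirDeriv_zero_mul_coordy dirDeriv_one_mul_coordx (dirDeriv_comm _ _)
  · exact LinearMap.ext fun k => by simp [mul_left_comm]

theorem weylRelations_verma : WeylRelations (-Verma.dxy 0) (-Verma.dxy 1) (Verma.mulxy 0)
    (Verma.mulxy 1) Verma.q Verma.dq := by
  have h (i : Fin 2) : -Verma.dxy i = LinearMap.rTensor ℂ[X]
      (-((MvPolynomial.pderiv i : Derivation ℂ (MvPolynomial (Fin 2) ℂ) _) :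
        MvPolynomial (Fin 2) ℂ →ₗ[ℂ] MvPolynomial (Fin 2) ℂ)) := by
    rw [LinearMap.rTensor_neg]
    rfl
  have comm (i j : Fin 2) (p : MvPolynomial (Fin 2) ℂ) :
      MvPolynomial.pderiv i (MvPolynomial.pderiv j p) =
        MvPolynomial.pderiv j (MvPolynomial.pderiv i p) := by
    -- The commutator of two derivations is again a derivation, and this one vanishes on the
    -- variables.
    have h0 : ⁅(MvPolynomial.pderiv i : Derivation ℂ (MvPolynomial (Fin 2) ℂ)
        (MvPolynomial (Fin 2) ℂ)), (MvPolynomial.pderiv j :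
        Derivation ℂ (MvPolynomial (Fin 2) ℂ) (MvPolynomial (Fin 2) ℂ))⁆ = 0 := by
      refine MvPolynomial.derivation_ext fun k => ?_
      simp [Derivation.commutator_apply, MvPolynomial.pderiv_X, Pi.single_apply, apply_ite]
    have h1 := DFunLike.congr_fun h0 p
    rwa [Derivation.commutator_apply, Derivation.zero_apply, sub_eq_zero] at h1
  rw [h, h]
  refine .tensor ?_ ?_ derq_mul_mulq ?_ ?_ ?_ ?_ <;> refine LinearMap.ext fun p => ?_
  · simp [Module.End.mul_apply]
  · simp [Module.End.mul_apply]
  · simp [Module.End.mul_apply, comm 1 0]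
  · simp [Module.End.mul_apply]
  · simp [Module.End.mul_apply]
  · simp [Module.End.mul_apply, mul_left_comm]

/-! ## Pairings -/

theorem pow_mul_eq {R : Type} [Ring R] [Algebra ℂ R] {f q : R} (h : f * q = q * f + 1) (n : ℕ) :
    f ^ n * q = q * f ^ n + (n : ℂ) • f ^ (n - 1) := by
  induction n with
  | zero => simp
  | succ n ih =>
    rw [pow_succ', mul_assoc, ih, mul_add, ← mul_assoc, h, add_mul, mul_smul_comm]
    rcases n with _ | n
    · simp
    · rw [← pow_succ']
      simp [mul_assoc, pow_succ', add_smul]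
      abel

/-- This is `[p(∂), q] = p'(∂)`, stated for any operators so that it serves both polynomials and
Schwartz functions. -/
theorem aeval_mul_eq {R : Type} [Ring R] [Algebra ℂ R] {f q : R} (h : f * q = q * f + 1)
    (p : ℂ[X]) : aeval f p * q = q * aeval f p + aeval f (derivative p) := by
  induction p using Polynomial.induction_on' with
  | add p r hp hr => simp only [map_add, add_mul, mul_add, hp, hr]; abel
  | monomial n a =>
    rw [derivative_monomial, aeval_monomial, aeval_monomial, ← Algebra.smul_def,
      ← Algebra.smul_def, smul_mul_assoc, pow_mul_eq h, mul_smul_comm, smul_add, smul_smul]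

theorem spinPairing_apply (p r : ℂ[X]) : spinPairing p r = (aeval derq p r).eval 0 := rfl

theorem spinPairing_mulq (p r : ℂ[X]) : spinPairing (mulq p) r = spinPairing p (derq r) := by
  simp only [spinPairing_apply, mulq, LinearMap.mulLeft_apply]
  rw [mul_comm, map_mul, aeval_X, Module.End.mul_apply]

/-- In `p(∂) q = q p(∂) + p'(∂)` the first term on the right disappears on evaluation at `q = 0`. -/
theorem spinPairing_derq (p r : ℂ[X]) : spinPairing (derq p) r = spinPairing p (mulq r) := by
  have h := congrArg (fun A : Module.End ℂ ℂ[X] => (A r).eval 0) (aeval_mul_eq derq_mul_mulq p)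
  simp only [Module.End.mul_apply, LinearMap.add_apply, eval_add] at h
  rw [spinPairing_apply, spinPairing_apply, h]
  simp [mulq, derq]

/-- Evaluation of smooth functions at the origin. -/
def evalOrigin : SmoothFun →ₗ[ℂ] ℂ :=
  LinearMap.proj (0 : ℝ × ℝ) ∘ₗ SmoothFun.val.toLinearMap

theorem evalOrigin_apply (g : SmoothFun) : evalOrigin g = (g : ℝ × ℝ → ℂ) 0 := rfl

theorem deltaPairing_monomial (m : Fin 2 →₀ ℕ) (g : SmoothFun) :
    deltaPairing (MvPolynomial.monomial m 1) g = (-1 : ℂ) ^ (m 0 + m 1) *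
      evalOrigin ((dirDeriv (1, 0) ^ m 0 * dirDeriv (0, 1) ^ m 1) g) := by
  rw [deltaPairing, ← congrFun (MvPolynomial.coe_basisMonomials (Fin 2) ℂ) m,
    Module.Basis.constr_basis]
  rfl

theorem linearMap_ext_monomial {W : Type} [AddCommGroup W] [Module ℂ W]
    {f g : MvPolynomial (Fin 2) ℂ →ₗ[ℂ] W}
    (h : ∀ m, f (MvPolynomial.monomial m 1) = g (MvPolynomial.monomial m 1)) : f = g :=
  (MvPolynomial.basisMonomials (Fin 2) ℂ).ext fun m => by simpa using h m

theorem deltaPairing_eq_neg {A : MvPolynomial (Fin 2) ℂ →ₗ[ℂ] MvPolynomial (Fin 2) ℂ}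
    {A' : Module.End ℂ SmoothFun}
    (h : ∀ m g, deltaPairing (A (MvPolynomial.monomial m 1)) g =
      -deltaPairing (MvPolynomial.monomial m 1) (A' g)) (P : MvPolynomial (Fin 2) ℂ)
    (g : SmoothFun) : deltaPairing (A P) g = -deltaPairing P (A' g) :=
  LinearMap.congr_fun (f := deltaPairing.flip g ∘ₗ A) (g := -deltaPairing.flip (A' g))
    (linearMap_ext_monomial fun m => h m g) P

theorem deltaPairing_mul_X_zero (P : MvPolynomial (Fin 2) ℂ) (g : SmoothFun) :
    deltaPairing (MvPolynomial.X 0 * P) g = -deltaPairing P (dirDeriv (1, 0) g) := by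
  refine deltaPairing_eq_neg (A := LinearMap.mulLeft ℂ (MvPolynomial.X 0)) (fun m g => ?_) P g
  have hc : Commute (dirDeriv (1, 0)) (dirDeriv (0, 1) ^ m 1) :=
    Commute.pow_right (dirDeriv_comm _ _) _
  have h0 : (Finsupp.single 0 1 + m : Fin 2 →₀ ℕ) 0 = m 0 + 1 := by simp [add_comm]
  have h1 : (Finsupp.single 0 1 + m : Fin 2 →₀ ℕ) 1 = m 1 := by simp
  rw [LinearMap.mulLeft_apply, MvPolynomial.X, MvPolynomial.monomial_mul, mul_one,
    deltaPairing_monomial, deltaPairing_monomial, ← Module.End.mul_apply, mul_assoc, ← hc.eq,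
    ← mul_assoc, ← pow_succ, h0, h1]
  ring

theorem deltaPairing_mul_X_one (P : MvPolynomial (Fin 2) ℂ) (g : SmoothFun) :
    deltaPairing (MvPolynomial.X 1 * P) g = -deltaPairing P (dirDeriv (0, 1) g) := by
  refine deltaPairing_eq_neg (A := LinearMap.mulLeft ℂ (MvPolynomial.X 1)) (fun m g => ?_) P g
  have h0 : (Finsupp.single 1 1 + m : Fin 2 →₀ ℕ) 0 = m 0 := by simp
  have h1 : (Finsupp.single 1 1 + m : Fin 2 →₀ ℕ) 1 = m 1 + 1 := by simp [add_comm]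
  rw [LinearMap.mulLeft_apply, MvPolynomial.X, MvPolynomial.monomial_mul, mul_one,
    deltaPairing_monomial, deltaPairing_monomial, ← Module.End.mul_apply, mul_assoc,
    ← pow_succ, h0, h1]
  ring

theorem deltaPairing_pderiv_monomial (i : Fin 2) (m : Fin 2 →₀ ℕ) (g : SmoothFun) :
    deltaPairing (MvPolynomial.pderiv i (MvPolynomial.monomial m 1)) g =
      m i * deltaPairing (MvPolynomial.monomial (m - Finsupp.single i 1) 1) g := by
  have hr : MvPolynomial.monomial (m - Finsupp.single i 1) ((m i : ℕ) : ℂ) =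
      (m i : ℂ) • MvPolynomial.monomial (m - Finsupp.single i 1) (1 : ℂ) := by
    simp [MvPolynomial.smul_monomial]
  rw [MvPolynomial.pderiv_monomial, one_mul, hr, map_smul, LinearMap.smul_apply, smul_eq_mul]

/-- Lowering an exponent by one costs a sign; for `a = 0` the truncated subtraction is harmless
because of the factor `a`. -/
theorem neg_one_pow_pred_add {a : ℕ} (b : ℕ) (z : ℂ) :
    a * ((-1 : ℂ) ^ (a - 1 + b) * z) = -((-1) ^ (a + b) * (a * z)) := by
  rcases a with _ | a
  · simp
  · rw [Nat.add_sub_cancel]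
    ring

/-- Commuting `∂_x̂ ^ m` past multiplication by `x̂` produces `m ∂_x̂ ^ (m - 1)` and a term with
`x̂` in front, which vanishes at the origin. -/
theorem deltaPairing_pderiv_zero (P : MvPolynomial (Fin 2) ℂ) (g : SmoothFun) :
    deltaPairing (MvPolynomial.pderiv 0 P) g = -deltaPairing P (coordx * g) := by
  rw [← LinearMap.mulLeft_apply (R := ℂ)]
  refine deltaPairing_eq_neg (A := ((MvPolynomial.pderiv 0 :
      Derivation ℂ (MvPolynomial (Fin 2) ℂ) (MvPolynomial (Fin 2) ℂ)) :
      MvPolynomial (Fin 2) ℂ →ₗ[ℂ] MvPolynomial (Fin 2) ℂ)) (fun m g => ?_) P g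
  have hy : Commute (dirDeriv (0, 1)) (LinearMap.mulLeft ℂ coordx) := dirDeriv_one_mul_coordx
  have key : (dirDeriv (1, 0) ^ m 0 * dirDeriv (0, 1) ^ m 1) * LinearMap.mulLeft ℂ coordx =
      LinearMap.mulLeft ℂ coordx * (dirDeriv (1, 0) ^ m 0 * dirDeriv (0, 1) ^ m 1) +
      (m 0 : ℂ) • (dirDeriv (1, 0) ^ (m 0 - 1) * dirDeriv (0, 1) ^ m 1) := by
    rw [mul_assoc, (hy.pow_left _).eq, ← mul_assoc, pow_mul_eq dirDeriv_zero_mul_coordx, add_mul,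
      mul_assoc, smul_mul_assoc]
  have h0 (A : Module.End ℂ SmoothFun) : evalOrigin ((LinearMap.mulLeft ℂ coordx * A) g) = 0 := by
    rw [Module.End.mul_apply, evalOrigin_apply, LinearMap.mulLeft_apply]
    simp [coordx]
  rw [Derivation.coeFn_coe, deltaPairing_pderiv_monomial, deltaPairing_monomial,
    deltaPairing_monomial, ← Module.End.mul_apply, key, LinearMap.add_apply, map_add,
    h0, LinearMap.smul_apply, map_smul, zero_add, smul_eq_mul]
  simpa using neg_one_pow_pred_add _ _

theorem deltaPairing_pderiv_one (P : MvPolynomial (Fin 2) ℂ) (g : SmoothFun) :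
    deltaPairing (MvPolynomial.pderiv 1 P) g = -deltaPairing P (coordy * g) := by
  rw [← LinearMap.mulLeft_apply (R := ℂ)]
  refine deltaPairing_eq_neg (A := ((MvPolynomial.pderiv 1 :
      Derivation ℂ (MvPolynomial (Fin 2) ℂ) (MvPolynomial (Fin 2) ℂ)) :
      MvPolynomial (Fin 2) ℂ →ₗ[ℂ] MvPolynomial (Fin 2) ℂ)) (fun m g => ?_) P g
  have hx : Commute (dirDeriv (1, 0)) (LinearMap.mulLeft ℂ coordy) := dirDeriv_zero_mul_coordy
  have key : (dirDeriv (1, 0) ^ m 0 * dirDeriv (0, 1) ^ m 1) * LinearMap.mulLeft ℂ coordy =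
      LinearMap.mulLeft ℂ coordy * (dirDeriv (1, 0) ^ m 0 * dirDeriv (0, 1) ^ m 1) +
      (m 1 : ℂ) • (dirDeriv (1, 0) ^ m 0 * dirDeriv (0, 1) ^ (m 1 - 1)) := by
    rw [mul_assoc, pow_mul_eq dirDeriv_one_mul_coordy, mul_add, ← mul_assoc, (hx.pow_left _).eq,
      mul_assoc, mul_smul_comm]
  have h0 (A : Module.End ℂ SmoothFun) : evalOrigin ((LinearMap.mulLeft ℂ coordy * A) g) = 0 := by
    rw [Module.End.mul_apply, evalOrigin_apply, LinearMap.mulLeft_apply]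
    simp [coordy]
  rw [Derivation.coeFn_coe, deltaPairing_pderiv_monomial, deltaPairing_monomial,
    deltaPairing_monomial, ← Module.End.mul_apply, key, LinearMap.add_apply, map_add,
    h0, LinearMap.smul_apply, map_smul, zero_add, smul_eq_mul]
  rw [add_comm (m 0) (m 1)]
  simpa [add_comm (m 0)] using neg_one_pow_pred_add _ _

theorem distPairing_tmul (P : MvPolynomial (Fin 2) ℂ) (p r : ℂ[X]) (g : SmoothFun) :
    distPairing (P ⊗ₜ p) (g ⊗ₜ r) = deltaPairing P g * spinPairing p r := by
  simp [distPairing]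

/-- An identity between bilinear forms on `ℂ[𝔲̄*] ⊗ 𝕊` and `C^∞ ⊗ 𝕊*` may be checked on decomposable
tensors. -/
theorem distPairing_transpose {A : Module.End ℂ VermaSpace} {A' : Module.End ℂ Field}
    (h : ∀ P p g r, distPairing (A (P ⊗ₜ p)) (g ⊗ₜ r) = distPairing (P ⊗ₜ p) (A' (g ⊗ₜ r)))
    (T : VermaSpace) (φ : Field) : distPairing (A T) φ = distPairing T (A' φ) := by
  induction T using TensorProduct.induction_on with
  | zero => simp
  | add S T hS hT => simp [hS, hT]
  | tmul P p =>
    induction φ using TensorProduct.induction_on with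
    | zero => simp
    | add φ ψ hφ hψ => simp [hφ, hψ]
    | tmul g r => exact h P p g r

theorem distPairing_dxy_zero (T : VermaSpace) (φ : Field) :
    distPairing ((-Verma.dxy 0) T) φ = distPairing T (Field.x φ) :=
  distPairing_transpose (fun P p g r => by
    simp [Verma.dxy, Field.x, distPairing_tmul, deltaPairing_pderiv_zero]) T φ

theorem distPairing_dxy_one (T : VermaSpace) (φ : Field) :
    distPairing ((-Verma.dxy 1) T) φ = distPairing T (Field.y φ) :=
  distPairing_transpose (fun P p g r => by
    simp [Verma.dxy, Field.y, distPairing_tmul, deltaPairing_pderiv_one]) T φ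

theorem distPairing_mulxy_zero (T : VermaSpace) (φ : Field) :
    distPairing (Verma.mulxy 0 T) φ = -distPairing T (Field.dx φ) := by
  rw [distPairing_transpose (A' := -Field.dx) (fun P p g r => by
    simp [Verma.mulxy, Field.dx, distPairing_tmul, deltaPairing_mul_X_zero])]
  simp

theorem distPairing_mulxy_one (T : VermaSpace) (φ : Field) :
    distPairing (Verma.mulxy 1 T) φ = -distPairing T (Field.dy φ) := by
  rw [distPairing_transpose (A' := -Field.dy) (fun P p g r => by
    simp [Verma.mulxy, Field.dy, distPairing_tmul, deltaPairing_mul_X_one])]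
  simp

theorem distPairing_q (T : VermaSpace) (φ : Field) :
    distPairing (Verma.q T) φ = distPairing T (Field.dq φ) :=
  distPairing_transpose (fun P p g r => by
    simp [Verma.q, Field.dq, distPairing_tmul, spinPairing_mulq]) T φ

theorem distPairing_dq (T : VermaSpace) (φ : Field) :
    distPairing (Verma.dq T) φ = distPairing T (Field.q φ) :=
  distPairing_transpose (fun P p g r => by
    simp [Verma.dq, Field.q, distPairing_tmul, spinPairing_derq]) T φ

theorem distPairing_piHat (lam : ℂ) (Z : sl3 ℂ) (T : VermaSpace) (φ : Field) :
    distPairing (piHat lam Z T) φ = -distPairing T (piDual (-lam) Z φ) :=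
  pairing_inducedAction distPairing weylRelations_field distPairing_dxy_zero distPairing_dxy_one
    distPairing_mulxy_zero distPairing_mulxy_one distPairing_q distPairing_dq lam
    (mem_sl3.1 Z.2) T φ

theorem distPairing_Xs (T : VermaSpace) (φ : Field) :
    distPairing (Xs T) φ = Complex.I * distPairing T (Ds φ) := by
  have hq (ψ : Field) : Field.q (Field.dy ψ) = Field.dy (Field.q ψ) :=
    LinearMap.congr_fun weylRelations_field.q_dy ψ
  have hdq (ψ : Field) : Field.dq (Field.dx ψ) = Field.dx (Field.dq ψ) :=
    LinearMap.congr_fun weylRelations_field.dq_dx ψ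
  simp only [Xs, Ds, LinearMap.add_apply, LinearMap.sub_apply, LinearMap.smul_apply, map_add,
    map_sub, map_smul, Module.End.mul_apply, distPairing_mulxy_zero, distPairing_mulxy_one,
    distPairing_q, distPairing_dq, hq, hdq, smul_eq_mul]
  linear_combination (-distPairing T (Field.dy (Field.q φ))) * Complex.I_mul_I

/-! ## The intertwining relations -/

theorem Ds_mul_piDual (X : sl3 ℝ) :
    Ds * piDual (-3 / 4) (complexify X) = piDual (3 / 4) (complexify X) * Ds :=
  weylRelations_field.dirac_mul_inducedAction <| by
    have h := congrArg (algebraMap ℝ ℂ) (mem_sl3.1 X.2)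
    rw [Matrix.trace_fin_three, map_add, map_add, map_zero] at h
    rw [Matrix.trace_fin_three]
    exact h

/-- Up to sign, `X_s` is the Dirac operator of the rotated, Fourier transformed Weyl generators, so
the universal identity applies to it. -/
theorem Xs_eq : Xs = (-1 : ℂ) • (Complex.I • ((Complex.I • Verma.dq) * Verma.mulxy 1) -
    Verma.mulxy 0 * (Complex.I • Verma.q)) := by
  simp only [Xs, smul_mul_assoc, mul_smul_comm, smul_smul, Complex.I_mul_I,
    weylRelations_verma.dq_dy]
  module

theorem Xs_mul_piHat {Z : Matrix (Fin 3) (Fin 3) ℂ} (hZ : Z.trace = 0) :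
    Xs * piHat (-3 / 4) Z = piHat (3 / 4) Z * Xs := by
  rw [piHat, piHat, metaplectic_eq_dualMetaplectic weylRelations_verma.dq_q, Xs_eq,
    smul_mul_assoc, mul_smul_comm (-1 : ℂ) (inducedAction _ _ _ _ _ _ _),
    weylRelations_verma.rotate.dirac_mul_inducedAction hZ]

/-- The action of the parabolic subalgebra on vectors killed by `x` and `y`. -/
theorem WeylRelations.inducedAction_apply {V : Type} [AddCommGroup V] [Module ℂ V]
    {x y dx dy q dq : Module.End ℂ V} (h : WeylRelations x y dx dy q dq) (lam : ℂ)
    {Z : Matrix (Fin 3) (Fin 3) ℂ} (hZ : Z.trace = 0) (h10 : Z 1 0 = 0) (h20 : Z 2 0 = 0) {v : V}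
    (hx : x v = 0) (hy : y v = 0) : inducedAction x y dx dy (metaplectic q dq) lam Z v =
      fiberAction (metaplectic q dq) (lam - rho) (Z.map (algebraMap ℂ (Module.End ℂ V))) v := by
  have h22 : Z 2 2 = -Z 0 0 - Z 1 1 := by
    rw [Matrix.trace_fin_three] at hZ
    linear_combination hZ
  have comm {a b : Module.End ℂ V} (hab : a * b = b * a) (u : V) : b (a u) = a (b u) :=
    (LinearMap.congr_fun hab u).symm
  have comm_one {a b : Module.End ℂ V} (hab : a * b = b * a + 1) (u : V) :
      b (a u) = a (b u) - u := by
    rw [eq_sub_iff_add_eq]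
    exact (LinearMap.congr_fun hab u).symm
  -- As `x v = y v = 0`, the operators `x ∂_x` and `y ∂_y` both act on `v` by `-1`. With trace zero
  -- this shifts the coefficient of `Z 0 0` by `-3`, that is, from `lam + ρ` to `lam - ρ`.
  rw [inducedAction_eq, h22, h10, h20]
  simp only [fiberAction, metaplectic, rho, Algebra.algebraMap_eq_smul_one, Matrix.map_apply, h22,
    LinearMap.add_apply, LinearMap.sub_apply, LinearMap.smul_apply, LinearMap.neg_apply,
    Module.End.mul_apply, Module.End.one_apply, map_sub, map_smul, map_neg, map_zero,
    comm h.q_x, comm h.q_y, comm h.dq_x, comm h.dq_y, comm h.dx_y, comm h.dy_x,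
    comm_one h.dx_x, comm_one h.dy_y, hx, hy]
  module

theorem piHat_one_tmul {Z : sl3 ℂ} (hZ : Z ∈ parabolic ℂ) (v : ℂ[X]) :
    piHat (-3 / 4) Z (1 ⊗ₜ v) = 1 ⊗ₜ sigma (-9 / 4) Z v := by
  have h := weylRelations_verma.inducedAction_apply (-3 / 4) (mem_sl3.1 Z.2) hZ.1 hZ.2
    (v := 1 ⊗ₜ[ℂ] v) (by simp [Verma.dxy]) (by simp [Verma.dxy])
  rw [piHat, h, sigma, rho, show (-3 / 4 - 3 / 2 : ℂ) = -9 / 4 by norm_num]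
  simp [fiberAction, metaplectic, Verma.q, Verma.dq, Algebra.algebraMap_eq_smul_one,
    TensorProduct.tmul_add, TensorProduct.tmul_sub, TensorProduct.tmul_smul,
    TensorProduct.tmul_neg]

theorem piHat_Xs_one_tmul {Z : sl3 ℂ} (hZ : Z ∈ parabolic ℂ) (v : ℂ[X]) :
    piHat (3 / 4) Z (Xs (1 ⊗ₜ v)) = Xs (1 ⊗ₜ sigma (-9 / 4) Z v) := by
  rw [← piHat_one_tmul hZ, ← Module.End.mul_apply, ← Xs_mul_piHat (mem_sl3.1 Z.2),
    Module.End.mul_apply]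

theorem Xs_one_tmul (v : ℂ[X]) : Xs (1 ⊗ₜ v) =
    MvPolynomial.X 1 ⊗ₜ derivative v + Complex.I • (MvPolynomial.X 0 ⊗ₜ (X * v)) := by
  simp [Xs, Verma.mulxy, Verma.q, Verma.dq, mulq, derq]

theorem nilradical_le_parabolic : nilradical ℂ ≤ parabolic ℂ := fun Z hZ =>
  ⟨by by_contra h; exact absurd (hZ _ _ h).1 (by decide),
    by by_contra h; exact absurd (hZ _ _ h).1 (by decide)⟩

theorem sigma_eq_zero_of_mem_nilradical (μ : ℂ) {Z : sl3 ℂ} (hZ : Z ∈ nilradical ℂ) :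
    sigma μ Z = 0 := by
  have h (i j : Fin 3) (hij : ¬(i = 0 ∧ j ≠ 0)) : (Z : Matrix (Fin 3) (Fin 3) ℂ) i j = 0 := by
    by_contra h
    exact hij (hZ _ _ h)
  simp [sigma, fiberAction, h]

/-- Singularity follows from equivariance, because the nilradical acts by zero on the inducing
module. -/
theorem Xs_one_tmul_mem_Sol (v : ℂ[X]) : Xs (1 ⊗ₜ v) ∈ Sol (3 / 4) := by
  intro Z hZ
  rw [piHat_Xs_one_tmul (nilradical_le_parabolic hZ), sigma_eq_zero_of_mem_nilradical _ hZ]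
  simp

theorem injective_Xs_one_tmul : Function.Injective fun v : ℂ[X] => Xs (1 ⊗ₜ[ℂ] v) := by
  -- The coefficient of the variable `x` recovers `i q v`, and multiplication by `q` is injective.
  let c : VermaSpace →ₗ[ℂ] ℂ[X] :=
    TensorProduct.lid ℂ ℂ[X] ∘ₗ (MvPolynomial.lcoeff ℂ (Finsupp.single 0 1)).rTensor ℂ[X]
  intro v w h
  have hc (v : ℂ[X]) : c (Xs (1 ⊗ₜ v)) = Complex.I • (X * v) := by
    rw [Xs_one_tmul]
    simp [c, MvPolynomial.coeff_X, Finsupp.single_left_inj]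
  have h' := congrArg c h
  simp only [hc] at h'
  exact mul_left_cancel₀ X_ne_zero (smul_right_injective _ Complex.I_ne_zero h')

/-! ## The restricted dual of the metaplectic module -/

theorem spinPairing_X_pow (n : ℕ) (r : ℂ[X]) :
    spinPairing (X ^ n) r = n.factorial * r.coeff n := by
  have h (r : ℂ[X]) : (derq ^ n) r = derivative^[n] r := by
    rw [Module.End.pow_apply]
    rfl
  rw [spinPairing_apply, map_pow, aeval_X, h, ← coeff_zero_eq_eval_zero, coeff_iterate_derivative,
    zero_add, Nat.descFactorial_self, nsmul_eq_mul]

theorem spinPairing_eq_sum (p r : ℂ[X]) :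
    spinPairing p r = ∑ n ∈ p.support, p.coeff n * (n.factorial * r.coeff n) := by
  conv_lhs => rw [p.as_sum_support]
  rw [map_sum, LinearMap.sum_apply]
  refine Finset.sum_congr rfl fun n _ => ?_
  rw [← mul_one (p.coeff n), ← smul_eq_mul, ← smul_monomial, map_smul, LinearMap.smul_apply,
    monomial_one_right_eq_X_pow, spinPairing_X_pow]
  simp

theorem sigma_hL (μ : ℂ) :
    sigma μ (complexify hL) = -(mulq * derq) - algebraMap ℂ (Module.End ℂ ℂ[X]) (1 / 2) := by
  simp only [sigma, fiberAction, complexify, hL, metaplectic]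
  simp [Algebra.algebraMap_eq_smul_one, ← add_smul]
  norm_num

theorem coeff_sigma_hL (μ : ℂ) (v : ℂ[X]) (n : ℕ) :
    (sigma μ (complexify hL) v).coeff n = (-n - 1 / 2) * v.coeff n := by
  have h : (X * derivative v).coeff n = n * v.coeff n := by
    rcases n with _ | n
    · simp
    · rw [coeff_X_mul, coeff_derivative, Nat.cast_succ]
      ring
  rw [sigma_hL]
  simp [mulq, derq, h]
  ring

theorem sigma_hL_X_pow (μ : ℂ) (n : ℕ) :
    sigma μ (complexify hL) (X ^ n) = (-n - 1 / 2 : ℂ) • X ^ n := by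
  ext k
  rw [coeff_sigma_hL, coeff_smul, smul_eq_mul, coeff_X_pow]
  split_ifs with h <;> simp [h]

/-- A vector of weight `c` pairing nontrivially with `r` shares some exponent `n` with `r`, and that
exponent forces `c = -n - 1/2`. -/
theorem flip_spinPairing_mem_restrictedDual (μ : ℂ) (r : ℂ[X]) :
    spinPairing.flip r ∈ restrictedDual (sigma μ (complexify hL)) := by
  refine (r.support.finite_toSet.image fun n : ℕ => (-n - 1 / 2 : ℂ)).subset ?_
  rintro c ⟨v, hv, hc⟩
  rw [LinearMap.flip_apply, spinPairing_eq_sum] at hc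
  obtain ⟨n, -, hn⟩ := Finset.exists_ne_zero_of_sum_ne_zero hc
  have h1 := congrArg (coeff · n) (Module.End.mem_eigenspace_iff.1 hv)
  simp only [coeff_sigma_hL, coeff_smul, smul_eq_mul] at h1
  refine ⟨n, ?_, mul_right_cancel₀ (left_ne_zero_of_mul hn) h1⟩
  exact mem_support_iff.2 (right_ne_zero_of_mul (right_ne_zero_of_mul hn))

theorem exists_spinPairing_eq {μ : ℂ} {ξ : Module.Dual ℂ ℂ[X]}
    (hξ : ξ ∈ restrictedDual (sigma μ (complexify hL))) : ∃ r, spinPairing.flip r = ξ := by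
  -- Distinct powers of `q` have distinct weights, so finitely many weights means finitely many
  -- exponents.
  have hinj : Function.Injective fun n : ℕ => (-n - 1 / 2 : ℂ) := fun m n h => by simpa using h
  have hfin : {n : ℕ | ξ (X ^ n) ≠ 0}.Finite := by
    refine (Set.Finite.preimage hinj.injOn hξ).subset fun n hn => ?_
    exact ⟨X ^ n, Module.End.mem_eigenspace_iff.2 (sigma_hL_X_pow μ n), hn⟩
  -- The division by `n!` normalizes `(q^n, q^n) = n!`.
  refine ⟨∑ n ∈ hfin.toFinset, monomial n (ξ (X ^ n) / n.factorial), ?_⟩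
  refine Polynomial.lhom_ext' fun n => LinearMap.ext_ring ?_
  rw [LinearMap.comp_apply, LinearMap.comp_apply, monomial_one_right_eq_X_pow,
    LinearMap.flip_apply, spinPairing_X_pow, finsetSum_coeff]
  simp only [coeff_monomial]
  rw [Finset.sum_ite_eq' hfin.toFinset n]
  split_ifs with h
  · exact mul_div_cancel₀ _ (Nat.cast_ne_zero.2 n.factorial_ne_zero)
  · simpa [eq_comm] using h

theorem flip_spinPairing_injective : Function.Injective spinPairing.flip := by
  intro r s h
  ext n
  have hn := LinearMap.congr_fun h (X ^ n)
  rw [LinearMap.flip_apply, LinearMap.flip_apply, spinPairing_X_pow, spinPairing_X_pow] at hn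
  exact mul_left_cancel₀ (Nat.cast_ne_zero.2 n.factorial_ne_zero) hn

/-- The identification of `ℂ[q]` with the restricted dual of `𝕊_μ`. -/
def restrictedDualEquiv (μ : ℂ) : ℂ[X] ≃ₗ[ℂ] restrictedDual (sigma μ (complexify hL)) :=
  LinearEquiv.ofBijective (spinPairing.flip.codRestrict _ (flip_spinPairing_mem_restrictedDual μ))
    ⟨fun _ _ h => flip_spinPairing_injective (congrArg Subtype.val h),
      fun ξ => (exists_spinPairing_eq ξ.2).imp fun _ h => Subtype.ext h⟩

theorem restrictedDualEquiv_apply (μ : ℂ) (r v : ℂ[X]) :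
    (restrictedDualEquiv μ r : Module.Dual ℂ ℂ[X]) v = spinPairing v r := rfl

/-- Transposition exchanges `q` and `∂_q` and reverses products, which sends each metaplectic
operator to minus its dual counterpart. -/
theorem spinPairing_sigmaDual (μ : ℂ) (Z : Matrix (Fin 3) (Fin 3) ℂ) (r v : ℂ[X]) :
    spinPairing v (sigmaDual (-μ) Z r) = -spinPairing (sigma μ Z v) r := by
  simp only [sigma, sigmaDual, fiberAction, metaplectic, dualMetaplectic, Matrix.map_apply,
    Algebra.algebraMap_eq_smul_one, smul_mul_assoc, one_mul, ← sub_smul, smul_smul,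
    LinearMap.add_apply, LinearMap.sub_apply, LinearMap.smul_apply, LinearMap.neg_apply,
    Module.End.mul_apply, Module.End.one_apply, map_add, map_sub, map_smul, map_neg,
    spinPairing_mulq, spinPairing_derq, smul_eq_mul]
  ring

/-! ## Operators on the Schwartz space -/

theorem hasDerivAt_schw (φ : Schw) (q : ℝ) : HasDerivAt φ (schwDerq φ q) q := by
  have h := (φ.differentiable q).hasDerivAt
  rwa [← SchwartzMap.derivCLM_apply ℂ] at h

theorem schwDerq_eq_of_hasDerivAt {φ ψ : Schw} (h : ∀ q, HasDerivAt φ (ψ q) q) :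
    schwDerq φ = ψ := by
  ext q
  exact (hasDerivAt_schw φ q).unique (h q)

theorem schwDerq_schwMulq (φ : Schw) : schwDerq (schwMulq φ) = schwMulq (schwDerq φ) + φ := by
  refine schwDerq_eq_of_hasDerivAt fun q => ?_
  have h : (schwMulq φ : ℝ → ℂ) = fun q : ℝ => (q : ℂ) * φ q := funext (schwMulq_apply φ)
  rw [h]
  refine ((Complex.ofRealCLM.hasDerivAt (x := q)).mul (hasDerivAt_schw φ q)).congr_deriv ?_
  simp [schwMulq_apply]
  ring

/-- Multiplication by the Gaussian phase `exp(i s q²)`. -/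
def gaussPhase (s : ℝ) : Schw →L[ℂ] Schw :=
  SchwartzMap.smulLeftCLM ℂ (fun q : ℝ => Complex.exp (Complex.I * (s * q ^ 2 : ℝ)))

theorem gaussPhase_apply (s : ℝ) (φ : Schw) (q : ℝ) :
    gaussPhase s φ q = Complex.exp (Complex.I * (s * q ^ 2 : ℝ)) * φ q := by
  rw [gaussPhase, SchwartzMap.smulLeftCLM_apply_apply (hasTemperateGrowth_gauss _), smul_eq_mul]

theorem opE_eq (t : ℝ) : opE t = gaussPhase (-t / 2) := rfl

theorem gaussPhase_schwMulq (s : ℝ) (φ : Schw) :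
    gaussPhase s (schwMulq φ) = schwMulq (gaussPhase s φ) := by
  ext q
  simp only [gaussPhase_apply, schwMulq_apply]
  ring

/-- Conjugation by a Gaussian phase is a shear: it fixes `q` and sends `∂_q` to `∂_q - 2 i s q`. -/
theorem gaussPhase_schwDerq (s : ℝ) (φ : Schw) :
    gaussPhase s (schwDerq φ) =
      schwDerq (gaussPhase s φ) - (2 * Complex.I * s) • schwMulq (gaussPhase s φ) := by
  rw [eq_sub_iff_add_eq, eq_comm]
  refine schwDerq_eq_of_hasDerivAt fun q => ?_
  have h : (gaussPhase s φ : ℝ → ℂ) =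
      fun q : ℝ => Complex.exp (Complex.I * (s * q ^ 2 : ℝ)) * φ q := funext (gaussPhase_apply s φ)
  rw [h]
  have h1 : HasDerivAt (fun q : ℝ => ((s * q ^ 2 : ℝ) : ℂ)) ((s * (2 * q) : ℝ) : ℂ) q := by
    have := ((hasDerivAt_pow 2 q).const_mul s).ofReal_comp
    simpa using this
  refine ((h1.const_mul Complex.I).cexp.mul (hasDerivAt_schw φ q)).congr_deriv ?_
  simp [schwMulq_apply, gaussPhase_apply]
  ring

/-! ### The Fourier transform and the action of `exp(t f)` -/

open FourierTransform

theorem fourier_schwDerq (φ : Schw) :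
    𝓕 (schwDerq φ) = (2 * Real.pi * Complex.I) • schwMulq (𝓕 φ) := by
  ext q
  have hd : (schwDerq φ : ℝ → ℂ) = deriv φ := rfl
  rw [SchwartzMap.fourier_coe, hd, Real.fourier_deriv φ.integrable φ.differentiable
    (schwDerq φ).integrable]
  simp [schwMulq_apply, SchwartzMap.fourier_coe]
  ring

theorem schwDerq_fourier (φ : Schw) :
    schwDerq (𝓕 φ) = -(2 * Real.pi * Complex.I) • 𝓕 (schwMulq φ) := by
  have hM : (schwMulq φ : ℝ → ℂ) = fun x : ℝ => x • φ x := funext fun x => by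
    rw [schwMulq_apply, Complex.real_smul]
  ext q
  have h := congrFun (Real.deriv_fourier φ.integrable (hM ▸ (schwMulq φ).integrable)) q
  have hf : (fun x : ℝ => (-2 * Real.pi * Complex.I * x) • φ x) =
      (-(2 * Real.pi * Complex.I) • schwMulq φ : Schw) := funext fun x => by
    rw [_root_.smul_apply, schwMulq_apply, smul_eq_mul, smul_eq_mul]
    ring
  rw [hf, ← SchwartzMap.fourier_coe, ← SchwartzMap.fourier_coe, FourierTransform.fourier_smul] at h
  exact h

theorem fourier_opF (t : ℝ) (φ : Schw) : 𝓕 (opF t φ) = gaussPhase (2 * Real.pi ^ 2 * t) (𝓕 φ) := by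
  rw [opF, SchwartzMap.fourierMultiplierCLM_apply, FourierTransform.fourier_fourierInv_eq]
  rfl

theorem fourier_schw_injective {φ ψ : Schw} (h : 𝓕 φ = 𝓕 ψ) : φ = ψ := by
  simpa using congrArg (𝓕⁻ : Schw → Schw) h

theorem opF_schwDerq (t : ℝ) (φ : Schw) : opF t (schwDerq φ) = schwDerq (opF t φ) := by
  apply fourier_schw_injective
  rw [fourier_opF, fourier_schwDerq, fourier_schwDerq, fourier_opF, map_smul, gaussPhase_schwMulq]

/-- This is the other shear, fixing `∂_q` and moving `q`; the Fourier transform converts it into the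
shear by a Gaussian phase with `s = 2 π² t`. -/
theorem opF_schwMulq (t : ℝ) (φ : Schw) :
    opF t (schwMulq φ) = schwMulq (opF t φ) - (Complex.I * t) • schwDerq (opF t φ) := by
  apply fourier_schw_injective
  have hc : (2 * Real.pi * Complex.I : ℂ) ≠ 0 := by simp [Real.pi_ne_zero]
  have hM (ψ : Schw) : 𝓕 (schwMulq ψ) = -(2 * Real.pi * Complex.I : ℂ)⁻¹ • schwDerq (𝓕 ψ) := by
    rw [schwDerq_fourier, smul_smul, neg_mul_neg, inv_mul_cancel₀ hc, one_smul]
  have hsub (ψ χ : Schw) : 𝓕 (ψ - χ) = 𝓕 ψ - 𝓕 χ := (FourierTransform.fourierCLM ℂ Schw).map_sub ψ χ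
  rw [hsub, FourierTransform.fourier_smul, fourier_schwDerq, fourier_opF,
    hM, hM, fourier_opF, map_smul, gaussPhase_schwDerq, smul_sub, smul_smul, smul_smul]
  congr 2
  field_simp
  push_cast
  linear_combination (-(2 * Real.pi ^ 2 * t) : ℂ) * Complex.I_sq

theorem opH_schwMulq (t : ℝ) (φ : Schw) :
    opH t (schwMulq φ) = (Real.exp t : ℂ) • schwMulq (opH t φ) := by
  ext q
  simp [opH_apply, schwMulq_apply]
  ring

theorem opH_schwDerq (t : ℝ) (φ : Schw) :
    opH t (schwDerq φ) = (Real.exp (-t) : ℂ) • schwDerq (opH t φ) := by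
  have h : schwDerq (opH t φ) = (Real.exp t : ℂ) • opH t (schwDerq φ) := by
    refine schwDerq_eq_of_hasDerivAt fun q => ?_
    have h : (opH t φ : ℝ → ℂ) = fun q : ℝ => (Real.exp (t / 2) : ℂ) * φ (q * Real.exp t) :=
      funext (opH_apply t φ)
    rw [h]
    have h1 := (hasDerivAt_schw φ (q * Real.exp t)).scomp q
      ((hasDerivAt_id q).mul_const (Real.exp t))
    refine (h1.const_mul (Real.exp (t / 2) : ℂ)).congr_deriv ?_
    simp [opH_apply]
    ring
  rw [h, smul_smul, ← Complex.ofReal_mul, ← Real.exp_add]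
  simp

/-! ## Velocities of curves in the Schwartz space -/

theorem HasVelocity.clm {c : ℝ → Schw} {v : Schw} (h : HasVelocity c v) (L : Schw →L[ℂ] Schw) :
    HasVelocity (fun t => L (c t)) (L v) := by
  refine ((L.continuous.tendsto v).comp h).congr fun t => ?_
  rw [Function.comp_apply, ContinuousLinearMap.map_smul_of_tower, map_sub]

theorem HasVelocity.hasDerivAt {c : ℝ → Schw} {v : Schw} (h : HasVelocity c v) (q : ℝ) :
    HasDerivAt (fun t => c t q) (v q) 0 := by
  have hc : Continuous fun φ : Schw => φ q :=
    (BoundedContinuousFunction.evalCLM ℂ q).continuous.comp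
      (SchwartzMap.toBoundedContinuousFunctionCLM ℂ ℝ ℂ).continuous
  rw [hasDerivAt_iff_tendsto_slope_zero]
  refine ((hc.tendsto v).comp h).congr fun t => ?_
  simp

/-- Evaluation at a point is continuous on the Schwartz space, so a velocity already known to exist
is found pointwise. Smoothness of the sections supplies the existence, and no convergence in the
Schwartz topology has to be proved for the metaplectic operators. -/
theorem HasVelocity.eq_of_hasDerivAt {c : ℝ → Schw} {v w : Schw} (h : HasVelocity c v)
    (hw : ∀ q, HasDerivAt (fun t => c t q) (w q) 0) : v = w := by
  ext q
  exact (h.hasDerivAt q).unique (hw q)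

theorem HasVelocity.gaussPhase {a : ℝ} {φ v : Schw}
    (h : HasVelocity (fun t => gaussPhase (a * t) φ) v) :
    v = (Complex.I * a) • schwMulq (schwMulq φ) := by
  refine h.eq_of_hasDerivAt fun q => ?_
  simp only [gaussPhase_apply]
  have h1 : HasDerivAt (fun t : ℝ => ((a * t * q ^ 2 : ℝ) : ℂ)) ((a * q ^ 2 : ℝ) : ℂ) 0 := by
    have := (((hasDerivAt_id (0 : ℝ)).const_mul a).mul_const (q ^ 2)).ofReal_comp
    simpa using this
  refine ((h1.const_mul Complex.I).cexp.mul_const (φ q)).congr_deriv ?_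
  simp [schwMulq_apply]
  ring

theorem HasVelocity.opE_neg {φ v : Schw} (h : HasVelocity (fun t => opE (-t) φ) v) :
    v = (Complex.I / 2) • schwMulq (schwMulq φ) := by
  have h1 : HasVelocity (fun t => SympDirac.gaussPhase (1 / 2 * t) φ) v := by
    refine h.congr fun t => ?_
    simp only [opE_eq]
    ring_nf
  rw [h1.gaussPhase]
  congr 1
  push_cast
  ring

theorem HasVelocity.opH_neg {φ v : Schw} (h : HasVelocity (fun t => opH (-t) φ) v) :
    v = -(schwMulq (schwDerq φ) + (1 / 2 : ℂ) • φ) := by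
  refine h.eq_of_hasDerivAt fun q => ?_
  simp only [opH_apply]
  have h1 : HasDerivAt (fun t : ℝ => q * Real.exp (-t)) (-q) 0 := by
    have := ((hasDerivAt_neg (0 : ℝ)).exp.const_mul q)
    simpa using this
  have h2 : HasDerivAt (fun t : ℝ => (Real.exp (-t / 2) : ℂ)) (-1 / 2 : ℂ) 0 := by
    have := (((hasDerivAt_neg (0 : ℝ)).div_const 2).exp).ofReal_comp
    simpa using this
  have h3 := (hasDerivAt_schw φ (q * Real.exp (-0))).scomp 0 h1
  refine (h2.mul h3).congr_deriv ?_
  simp [schwMulq_apply]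
  ring

/-- The curve is not explicit pointwise in `q`, but its Fourier transform is a curve of Gaussian
phases. -/
theorem HasVelocity.opF_neg {φ v : Schw} (h : HasVelocity (fun t => opF (-t) φ) v) :
    v = (Complex.I / 2) • schwDerq (schwDerq φ) := by
  apply fourier_schw_injective
  have h1 : HasVelocity (fun t => SympDirac.gaussPhase (-(2 * Real.pi ^ 2) * t) (𝓕 φ)) (𝓕 v) := by
    refine (h.clm (FourierTransform.fourierCLM ℂ Schw)).congr fun t => ?_
    simp only [FourierTransform.fourierCLM_apply, fourier_opF]
    ring_nf
  rw [h1.gaussPhase, FourierTransform.fourier_smul, fourier_schwDerq, fourier_schwDerq, map_smul,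
    smul_smul, smul_smul]
  congr 1
  push_cast
  linear_combination (-2 * Real.pi ^ 2 * Complex.I : ℂ) * Complex.I_sq

theorem HasVelocity.exp_smul {μ : ℝ} {φ v : Schw}
    (h : HasVelocity (fun t => (Real.exp (μ * -t) : ℂ) • φ) v) : v = -(μ : ℂ) • φ := by
  refine h.eq_of_hasDerivAt fun q => ?_
  have h2 : HasDerivAt (fun t : ℝ => (Real.exp (μ * -t) : ℂ)) (-μ : ℂ) 0 := by
    have := (((hasDerivAt_neg (0 : ℝ)).const_mul μ).exp).ofReal_comp
    simpa using this
  exact h2.mul_const (φ q)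

/-! ## Exponentials in `S̃L(3, ℝ)` -/

theorem mk_eq_of_homotopicRel {a b : pathGroup}
    (h : (a : C(unitInterval, SL3)).HomotopicRel b {0, 1}) : (a : Gt) = (b : Gt) := by
  refine QuotientGroup.eq.2 ?_
  have h1 := homotopicRel_mul (ContinuousMap.HomotopicRel.refl
    ((a : C(unitInterval, SL3))⁻¹) (S := {0, 1})) h
  rw [inv_mul_cancel] at h1
  exact h1.symm

theorem coe_expSL (X : sl3 ℝ) : (expSL X : Matrix (Fin 3) (Fin 3) ℝ) =
    NormedSpace.exp (X : Matrix (Fin 3) (Fin 3) ℝ) := rfl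

theorem expSL_zero : expSL 0 = 1 := by
  apply Subtype.ext
  simp [expSL]

theorem expSL_add {X Y : sl3 ℝ} (h : Commute (X : Matrix (Fin 3) (Fin 3) ℝ) Y) :
    expSL X * expSL Y = expSL (X + Y) := by
  apply Subtype.ext
  rw [Matrix.SpecialLinearGroup.coe_mul, coe_expSL, coe_expSL]
  exact (Matrix.exp_add_of_commute _ _ h).symm

theorem expT_add {X Y : sl3 ℝ} (h : Commute (X : Matrix (Fin 3) (Fin 3) ℝ) Y) :
    expT X * expT Y = expT (X + Y) := by
  refine congrArg (QuotientGroup.mk : pathGroup → Gt) (Subtype.ext (ContinuousMap.ext fun t => ?_))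
  change expSL ((t : ℝ) • X) * expSL ((t : ℝ) • Y) = expSL ((t : ℝ) • (X + Y))
  rw [smul_add]
  exact expSL_add ((h.smul_left _).smul_right _)

theorem expT_zero : expT 0 = 1 := by
  refine congrArg (QuotientGroup.mk : pathGroup → Gt) (Subtype.ext (ContinuousMap.ext fun t => ?_))
  change expSL ((t : ℝ) • (0 : sl3 ℝ)) = 1
  rw [smul_zero, expSL_zero]

theorem expT_smul_mul_expT_smul (X : sl3 ℝ) (s t : ℝ) :
    expT (s • X) * expT (t • X) = expT ((s + t) • X) := by
  rw [add_smul]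
  exact expT_add (((Commute.refl _).smul_left s).smul_right t)

theorem mul_expSL_of_mul_eq {A : SL3} {X Y : sl3 ℝ}
    (h : (A : Matrix (Fin 3) (Fin 3) ℝ) * X = Y * A) : A * expSL X = expSL Y * A := by
  have hu : IsUnit (A : Matrix (Fin 3) (Fin 3) ℝ) := by
    rw [Matrix.isUnit_iff_isUnit_det, A.2]
    exact isUnit_one
  have hd : IsUnit (A : Matrix (Fin 3) (Fin 3) ℝ).det := (Matrix.isUnit_iff_isUnit_det _).1 hu
  have hY : (Y : Matrix (Fin 3) (Fin 3) ℝ) = A * X * (A : Matrix (Fin 3) (Fin 3) ℝ)⁻¹ := by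
    rw [h, Matrix.mul_nonsing_inv_cancel_right _ _ hd]
  apply Subtype.ext
  rw [Matrix.SpecialLinearGroup.coe_mul, Matrix.SpecialLinearGroup.coe_mul, coe_expSL, coe_expSL,
    hY, Matrix.exp_conj _ _ hu, Matrix.nonsing_inv_mul_cancel_right _ _ hd]

/-- Conjugation of one-parameter subgroups in `S̃L(3, ℝ)` is given by the adjoint action of
`SL(3, ℝ)`. -/
theorem mul_expT_of_mul_eq {g : Gt} {X Y : sl3 ℝ}
    (h : (proj g : Matrix (Fin 3) (Fin 3) ℝ) * X = Y * (proj g : Matrix (Fin 3) (Fin 3) ℝ)) :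
    g * expT X = expT Y * g := by
  obtain ⟨γ, rfl⟩ := QuotientGroup.mk_surjective g
  let c : C(unitInterval, SL3) := γ
  have h0 : c 0 = 1 := γ.2
  have hc (s : unitInterval) : c 1 * expSL ((s : ℝ) • X) = expSL ((s : ℝ) • Y) * c 1 := by
    refine mul_expSL_of_mul_eq ?_
    have h' : (c 1 : Matrix (Fin 3) (Fin 3) ℝ) * X = Y * (c 1 : Matrix (Fin 3) (Fin 3) ℝ) := h
    rw [Submodule.coe_smul, Submodule.coe_smul, Matrix.mul_smul, Matrix.smul_mul, h']
  -- At time `u` the conjugating element at `s` is `c (max u s)`. It moves from `c s`, which gives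
  -- `γ exp(sX)`, to the end point `c 1`, which gives `exp(sY) γ`, while both end points of the path
  -- stay fixed.
  refine mk_eq_of_homotopicRel (a := γ * expPath X) (b := expPath Y * γ) ⟨{
    toFun := fun p => c (p.1 ⊔ p.2) * (expPath X : C(unitInterval, SL3)) p.2 *
      (c (p.1 ⊔ p.2))⁻¹ * c p.2
    continuous_toFun := by fun_prop
    map_zero_left := fun s => ?_
    map_one_left := fun s => ?_
    prop' := fun u s hs => ?_ }⟩
  · change c (0 ⊔ s) * expSL ((s : ℝ) • X) * (c (0 ⊔ s))⁻¹ * c s = c s * expSL ((s : ℝ) • X)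
    rw [sup_of_le_right unitInterval.nonneg', inv_mul_cancel_right]
  · change c (1 ⊔ s) * expSL ((s : ℝ) • X) * (c (1 ⊔ s))⁻¹ * c s = expSL ((s : ℝ) • Y) * c s
    rw [sup_of_le_left unitInterval.le_one', hc, mul_inv_cancel_right]
  · change c (u ⊔ s) * expSL ((s : ℝ) • X) * (c (u ⊔ s))⁻¹ * c s = c s * expSL ((s : ℝ) • X)
    rcases hs with rfl | rfl
    · simp [h0, expSL_zero]
    · rw [sup_of_le_right unitInterval.le_one', inv_mul_cancel_right]

theorem exp_eq_one_add {A : Matrix (Fin 3) (Fin 3) ℝ} (h : A * A = 0) :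
    NormedSpace.exp A = 1 + A := by
  rw [NormedSpace.exp_eq_tsum ℝ]
  change ∑' n : ℕ, ((n.factorial : ℝ)⁻¹) • A ^ n = _
  rw [tsum_eq_sum (s := Finset.range 2)]
  · simp [Finset.sum_range_succ]
  · intro n hn
    obtain ⟨k, rfl⟩ := Nat.exists_eq_add_of_le (not_lt.1 (Finset.mem_range.not.1 hn))
    rw [pow_add, pow_two, h, zero_mul, smul_zero]

/-! ## Right derivatives of smooth functions -/

theorem rightDeriv_eq_of_hasVelocity {X : sl3 ℝ} {F : smoothFunctions} {g : Gt} {v : Schw}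
    (h : HasVelocity (fun t => (F : Gt → Schw) (g * expT (t • X))) v) :
    (rightDeriv X F : Gt → Schw) g = v :=
  (rightDeriv_spec X F g).unique h

theorem exists_linear_rightDeriv (F : smoothFunctions) : ∃ F' : sl3 ℝ →ₗ[ℝ] (Gt → Schw),
    ∀ X, (rightDeriv X F : Gt → Schw) = F' X := by
  obtain ⟨-, F', hF', -⟩ := mem_smoothFunctions.1 F.2 1
  exact ⟨F', fun X => funext fun g => rightDeriv_eq_of_hasVelocity (hF' X g)⟩

theorem rightDeriv_add (X Y : sl3 ℝ) (F : smoothFunctions) (g : Gt) :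
    (rightDeriv (X + Y) F : Gt → Schw) g =
      (rightDeriv X F : Gt → Schw) g + (rightDeriv Y F : Gt → Schw) g := by
  obtain ⟨F', hF'⟩ := exists_linear_rightDeriv F
  rw [hF', hF', hF', map_add, Pi.add_apply]

theorem rightDeriv_smul (a : ℝ) (X : sl3 ℝ) (F : smoothFunctions) (g : Gt) :
    (rightDeriv (a • X) F : Gt → Schw) g = (a : ℂ) • (rightDeriv X F : Gt → Schw) g := by
  obtain ⟨F', hF'⟩ := exists_linear_rightDeriv F
  rw [hF', hF', map_smul, Pi.smul_apply, Complex.coe_smul]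

theorem IsCk.clm {n : ℕ} (L : Schw →L[ℂ] Schw) :
    ∀ {F : Gt → Schw}, IsCk n F → IsCk n (fun g => L (F g)) := by
  induction n with
  | zero => exact fun hF => L.continuous.comp hF
  | succ n ih =>
    rintro F ⟨hF, F', hF', hF''⟩
    exact ⟨L.continuous.comp hF,
      { toFun := fun X g => L (F' X g)
        map_add' := fun X Y => by ext1 g; simp
        map_smul' := fun a X => by ext1 g; simp [ContinuousLinearMap.map_smul_of_tower] },
      fun X g => (hF' X g).clm L, fun X => ih (hF'' X)⟩

/-- Composition of smooth functions with a continuous operator of the Schwartz space. -/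
def postcomp (L : Schw →L[ℂ] Schw) : Module.End ℂ smoothFunctions where
  toFun F := ⟨fun g => L ((F : Gt → Schw) g), mem_smoothFunctions.2 fun n =>
    (mem_smoothFunctions.1 F.2 n).clm L⟩
  map_add' _ _ := Subtype.ext (funext fun _ => L.map_add _ _)
  map_smul' _ _ := Subtype.ext (funext fun _ => L.map_smul _ _)

/-- The symplectic Dirac operator `i q R(f₂) - ∂_q R(f₁)` on smooth functions on `S̃L(3, ℝ)`. -/
def diracSmooth : Module.End ℂ smoothFunctions :=
  Complex.I • (postcomp schwMulq * rightDeriv f₂) - postcomp schwDerq * rightDeriv f₁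

theorem diracSmooth_apply (F : smoothFunctions) (g : Gt) : (diracSmooth F : Gt → Schw) g =
    Complex.I • schwMulq ((rightDeriv f₂ F : Gt → Schw) g) -
      schwDerq ((rightDeriv f₁ F : Gt → Schw) g) := rfl

/-! ## Invariance of the Dirac operator under the parabolic subgroup -/

section invariance

variable {μ : ℝ} {F : smoothFunctions}

/-- With `Y = Ad(p) X` one has `p exp(tX) = exp(tY) p`, and equivariance of `F` absorbs the final
`p` into `T`. -/
theorem apply_rightDeriv_mul (hF : F ∈ principalSeries μ) {p : Pt} {T : Schw →L[ℂ] Schw}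
    (hp : MetaplecticGenerator μ p T) {X Y : sl3 ℝ}
    (h : (proj p : Matrix (Fin 3) (Fin 3) ℝ) * X = Y * (proj p : Matrix (Fin 3) (Fin 3) ℝ))
    (g : Gt) : T ((rightDeriv X F : Gt → Schw) (g * p)) = (rightDeriv Y F : Gt → Schw) g := by
  refine (rightDeriv_eq_of_hasVelocity ?_).symm
  refine ((rightDeriv_spec X F (g * p)).clm T).congr fun t => ?_
  have key (t : ℝ) : T ((F : Gt → Schw) (g * p * expT (t • X))) =
      (F : Gt → Schw) (g * expT (t • Y)) := by
    have hc : (p : Gt) * expT (t • X) = expT (t • Y) * p := by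
      refine mul_expT_of_mul_eq ?_
      rw [Submodule.coe_smul, Submodule.coe_smul, Matrix.mul_smul, Matrix.smul_mul, h]
    rw [mul_assoc, hc, ← mul_assoc]
    exact mem_principalSeries.1 hF (p, T) (Submonoid.subset_closure hp) (g * expT (t • Y))
  simp only [key]

theorem apply_mul_expT_smul (hF : F ∈ principalSeries μ) {Z : sl3 ℝ} {T : ℝ → Schw →L[ℂ] Schw}
    (hZ : Z ∈ parabolic ℝ)
    (hT : ∀ (t : ℝ) (p : Pt), (p : Gt) = expT (t • Z) → MetaplecticGenerator μ p (T t))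
    (g : Gt) (t : ℝ) : (F : Gt → Schw) (g * expT (t • Z)) = T (-t) ((F : Gt → Schw) g) := by
  have hm : expT (-t • Z) ∈ Pt := expT_mem_Pt (Submodule.smul_mem _ _ hZ)
  have h := mem_principalSeries.1 hF (⟨_, hm⟩, T (-t))
    (Submonoid.subset_closure (hT _ _ rfl)) (g * expT (t • Z))
  rw [← h]
  change T (-t) ((F : Gt → Schw) (g * expT (t • Z) * expT (-t • Z))) = _
  rw [mul_assoc, expT_smul_mul_expT_smul, add_neg_cancel, zero_smul, expT_zero, mul_one]

/-- Along `𝔭` a section varies by the inverse of the inducing representation, so `R(Z)` is an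
operator in the fibre variable alone. -/
theorem hasVelocity_rightDeriv (hF : F ∈ principalSeries μ) {Z : sl3 ℝ}
    {T : ℝ → Schw →L[ℂ] Schw} (hZ : Z ∈ parabolic ℝ)
    (hT : ∀ (t : ℝ) (p : Pt), (p : Gt) = expT (t • Z) → MetaplecticGenerator μ p (T t)) (g : Gt) :
    HasVelocity (fun t => T (-t) ((F : Gt → Schw) g)) ((rightDeriv Z F : Gt → Schw) g) := by
  have h := rightDeriv_spec Z F g
  simp only [apply_mul_expT_smul hF hZ hT] at h
  exact h

theorem rightDeriv_eL (hF : F ∈ principalSeries μ) (g : Gt) :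
    (rightDeriv eL F : Gt → Schw) g =
      (Complex.I / 2) • schwMulq (schwMulq ((F : Gt → Schw) g)) :=
  (hasVelocity_rightDeriv hF (by simp [parabolic, eL]) MetaplecticGenerator.e g).opE_neg

theorem rightDeriv_hL (hF : F ∈ principalSeries μ) (g : Gt) :
    (rightDeriv hL F : Gt → Schw) g =
      -(schwMulq (schwDerq ((F : Gt → Schw) g)) + (1 / 2 : ℂ) • (F : Gt → Schw) g) :=
  (hasVelocity_rightDeriv hF (by simp [parabolic, hL]) MetaplecticGenerator.h g).opH_neg

theorem rightDeriv_fL (hF : F ∈ principalSeries μ) (g : Gt) :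
    (rightDeriv fL F : Gt → Schw) g =
      (Complex.I / 2) • schwDerq (schwDerq ((F : Gt → Schw) g)) :=
  (hasVelocity_rightDeriv hF (by simp [parabolic, fL]) MetaplecticGenerator.f g).opF_neg

theorem rightDeriv_h₀ (hF : F ∈ principalSeries μ) (g : Gt) :
    (rightDeriv h₀ F : Gt → Schw) g = -(μ : ℂ) • (F : Gt → Schw) g :=
  (hasVelocity_rightDeriv hF (by simp [parabolic, h₀]) MetaplecticGenerator.h₀ g).exp_smul

theorem rightDeriv_nilradical (hF : F ∈ principalSeries μ) (a b : ℝ) (g : Gt) :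
    (rightDeriv (a • e₁ + b • e₂) F : Gt → Schw) g = 0 := by
  have h := hasVelocity_rightDeriv hF (Z := a • e₁ + b • e₂)
    (T := fun _ => ContinuousLinearMap.id ℂ Schw) (by simp [parabolic, e₁, e₂])
    (fun t p hp => MetaplecticGenerator.u (t * a) (t * b) p (by
      rw [hp, smul_add, smul_smul, smul_smul])) g
  refine h.unique ?_
  simp [HasVelocity]

end invariance

/-! ### Invariance under each generating one-parameter group -/

section generators

variable {F : smoothFunctions}

theorem coe_proj_of_eq_expT {p : Pt} {X : sl3 ℝ} (h : (p : Gt) = expT X) :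
    (proj p : Matrix (Fin 3) (Fin 3) ℝ) = NormedSpace.exp (X : Matrix (Fin 3) (Fin 3) ℝ) := by
  rw [h, proj_expT, coe_expSL]

theorem coe_proj_of_eq_expT_of_sq_eq_zero {p : Pt} {X : sl3 ℝ} (h : (p : Gt) = expT X)
    (hX : (X : Matrix (Fin 3) (Fin 3) ℝ) * X = 0) :
    (proj p : Matrix (Fin 3) (Fin 3) ℝ) = 1 + X := by
  rw [coe_proj_of_eq_expT h, exp_eq_one_add hX]

theorem coe_proj_of_eq_expT_of_diagonal {p : Pt} {X : sl3 ℝ} {d : Fin 3 → ℝ}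
    (h : (p : Gt) = expT X) (hX : (X : Matrix (Fin 3) (Fin 3) ℝ) = Matrix.diagonal d) :
    (proj p : Matrix (Fin 3) (Fin 3) ℝ) = Matrix.diagonal fun i => Real.exp (d i) := by
  rw [coe_proj_of_eq_expT h, hX, Matrix.exp_diagonal, Real.exp_eq_exp_ℝ]
  congr 1
  ext i
  exact Pi.coe_exp d i

/-- The extra `t f₁` in `Ad(p) f₂` contributes `i t q R(f₁)`, which the shear `∂_q ↦ ∂_q + i t q`
removes. -/
theorem apply_diracSmooth_e (hF : F ∈ principalSeries (3 / 4)) {t : ℝ} {p : Pt}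
    (hp : (p : Gt) = expT (t • eL)) (g : Gt) :
    opE t ((diracSmooth F : Gt → Schw) (g * p)) = (diracSmooth F : Gt → Schw) g := by
  have hA := coe_proj_of_eq_expT_of_sq_eq_zero hp (by ext i j; fin_cases i <;> fin_cases j <;>
    simp [eL, Matrix.mul_apply, Fin.sum_univ_three])
  have h1 := apply_rightDeriv_mul hF (.e t p hp) (X := f₁) (Y := f₁) (by
    rw [hA]; ext i j; fin_cases i <;> fin_cases j <;>
      simp [eL, f₁, Matrix.mul_apply, Fin.sum_univ_three]) g
  have h2 := apply_rightDeriv_mul hF (.e t p hp) (X := f₂) (Y := f₂ + t • f₁) (by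
    rw [hA]; ext i j; fin_cases i <;> fin_cases j <;>
      simp [eL, f₁, f₂, Matrix.mul_apply, Fin.sum_univ_three, Matrix.one_apply]) g
  rw [rightDeriv_add, rightDeriv_smul] at h2
  rw [diracSmooth_apply, diracSmooth_apply, map_sub, map_smul]
  rw [opE_eq] at h1 h2 ⊢
  rw [gaussPhase_schwMulq, gaussPhase_schwDerq, h1, h2, map_add, map_smul]
  push_cast
  module

theorem apply_diracSmooth_f (hF : F ∈ principalSeries (3 / 4)) {t : ℝ} {p : Pt}
    (hp : (p : Gt) = expT (t • fL)) (g : Gt) :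
    opF t ((diracSmooth F : Gt → Schw) (g * p)) = (diracSmooth F : Gt → Schw) g := by
  have hA := coe_proj_of_eq_expT_of_sq_eq_zero hp (by ext i j; fin_cases i <;> fin_cases j <;>
    simp [fL, Matrix.mul_apply, Fin.sum_univ_three])
  have h1 := apply_rightDeriv_mul hF (.f t p hp) (X := f₁) (Y := f₁ + t • f₂) (by
    rw [hA]; ext i j; fin_cases i <;> fin_cases j <;>
      simp [fL, f₁, f₂, Matrix.mul_apply, Fin.sum_univ_three, Matrix.one_apply]) g
  have h2 := apply_rightDeriv_mul hF (.f t p hp) (X := f₂) (Y := f₂) (by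
    rw [hA]; ext i j; fin_cases i <;> fin_cases j <;>
      simp [fL, f₂, Matrix.mul_apply, Fin.sum_univ_three]) g
  rw [rightDeriv_add, rightDeriv_smul] at h1
  rw [diracSmooth_apply, diracSmooth_apply, map_sub, map_smul, opF_schwMulq, opF_schwDerq, h1, h2,
    map_add, map_smul, smul_sub, smul_smul, ← mul_assoc, Complex.I_mul_I]
  module

theorem apply_diracSmooth_h (hF : F ∈ principalSeries (3 / 4)) {t : ℝ} {p : Pt}
    (hp : (p : Gt) = expT (t • hL)) (g : Gt) :
    opH t ((diracSmooth F : Gt → Schw) (g * p)) = (diracSmooth F : Gt → Schw) g := by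
  have hA := coe_proj_of_eq_expT_of_diagonal (d := ![0, t, -t]) hp (by
    ext i j; fin_cases i <;> fin_cases j <;> simp [hL])
  have h1 := apply_rightDeriv_mul hF (.h t p hp) (X := f₁) (Y := Real.exp t • f₁) (by
    rw [hA]; ext i j; fin_cases i <;> fin_cases j <;> simp [f₁]) g
  have h2 := apply_rightDeriv_mul hF (.h t p hp) (X := f₂) (Y := Real.exp (-t) • f₂) (by
    rw [hA]; ext i j; fin_cases i <;> fin_cases j <;> simp [f₂]) g
  have he : (Real.exp t * Real.exp (-t) : ℂ) = 1 := by
    rw [← Complex.ofReal_mul, ← Real.exp_add]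
    simp
  rw [rightDeriv_smul] at h1 h2
  rw [diracSmooth_apply, diracSmooth_apply, map_sub, map_smul, opH_schwMulq, opH_schwDerq, h1, h2,
    map_smul, map_smul, smul_smul, smul_smul, smul_smul, mul_assoc,
    mul_comm (Real.exp (-t) : ℂ), he, mul_one, one_smul]

/-- Both `f₁` and `f₂` scale by `exp(-3t/2)` under `exp(t h₀)`, and this raises the twist from `3/4`
to `3/4 + 3/2 = 9/4`. -/
theorem apply_diracSmooth_h₀ (hF : F ∈ principalSeries (3 / 4)) {t : ℝ} {p : Pt}
    (hp : (p : Gt) = expT (t • h₀)) (g : Gt) :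
    (Real.exp (9 / 4 * t) : ℂ) • (diracSmooth F : Gt → Schw) (g * p) =
      (diracSmooth F : Gt → Schw) g := by
  have hA := coe_proj_of_eq_expT_of_diagonal (d := ![t, -t / 2, -t / 2]) hp (by
    ext i j; fin_cases i <;> fin_cases j <;> simp [h₀] <;> ring)
  have he : Real.exp (-(3 / 2) * t) * Real.exp t = Real.exp (-t / 2) := by
    rw [← Real.exp_add]
    ring_nf
  have h1 := apply_rightDeriv_mul hF (.h₀ t p hp) (X := f₁) (Y := Real.exp (-(3 / 2) * t) • f₁) (by
    rw [hA]; ext i j; fin_cases i <;> fin_cases j <;> simp [f₁, ← he]) g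
  have h2 := apply_rightDeriv_mul hF (.h₀ t p hp) (X := f₂) (Y := Real.exp (-(3 / 2) * t) • f₂) (by
    rw [hA]; ext i j; fin_cases i <;> fin_cases j <;> simp [f₂, ← he]) g
  have hs : (Real.exp (9 / 4 * t) : ℂ) = Real.exp (3 / 2 * t) * Real.exp (3 / 4 * t) := by
    rw [← Complex.ofReal_mul, ← Real.exp_add]
    ring_nf
  have hs' : (Real.exp (3 / 2 * t) * Real.exp (-(3 / 2) * t) : ℂ) = 1 := by
    rw [← Complex.ofReal_mul, ← Real.exp_add]
    simp
  have key (v w : Schw) (h : ((Real.exp (3 / 4 * t) : ℂ) • ContinuousLinearMap.id ℂ Schw) v =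
      (Real.exp (-(3 / 2) * t) : ℂ) • w) : (Real.exp (9 / 4 * t) : ℂ) • v = w := by
    have h' : (Real.exp (3 / 4 * t) : ℂ) • v = (Real.exp (-(3 / 2) * t) : ℂ) • w := h
    rw [hs, mul_smul, h', smul_smul, hs', one_smul]
  rw [rightDeriv_smul] at h1 h2
  rw [diracSmooth_apply, diracSmooth_apply, smul_sub, smul_comm _ Complex.I,
    ← schwMulq.map_smul, ← schwDerq.map_smul, key _ _ h1, key _ _ h2]

theorem apply_diracSmooth_u (hF : F ∈ principalSeries (3 / 4)) {t s : ℝ} {p : Pt}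
    (hp : (p : Gt) = expT (t • e₁ + s • e₂)) (g : Gt) :
    (diracSmooth F : Gt → Schw) (g * p) = (diracSmooth F : Gt → Schw) g := by
  have hA := coe_proj_of_eq_expT_of_sq_eq_zero hp (by ext i j; fin_cases i <;> fin_cases j <;>
    simp [e₁, e₂, Matrix.mul_apply, Fin.sum_univ_three])
  -- With `N = t e₁ + s e₂` and `p = 1 + N`, the witness is `(1 + N) f₁ (1 - N) = f₁ + [N, f₁] - N
  -- f₁ N`, expanded in the basis; likewise for `f₂`. The quadratic terms lie in the nilradical and
  -- contribute nothing.
  have h1 := apply_rightDeriv_mul hF (.u t s p hp) (X := f₁)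
    (Y := f₁ + (t • h₀ + ((-t / 2) • hL + (-s • eL + (-t * t) • e₁ + (-t * s) • e₂)))) (by
      rw [hA]; ext i j; fin_cases i <;> fin_cases j <;>
        simp [f₁, h₀, hL, eL, e₁, e₂, Matrix.mul_apply, Fin.sum_univ_three, Matrix.one_apply] <;>
        ring) g
  have h2 := apply_rightDeriv_mul hF (.u t s p hp) (X := f₂)
    (Y := f₂ + (s • h₀ + ((s / 2) • hL + (-t • fL + ((-s * t) • e₁ + (-s * s) • e₂))))) (by
      rw [hA]; ext i j; fin_cases i <;> fin_cases j <;>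
        simp [f₂, h₀, hL, fL, e₁, e₂, Matrix.mul_apply, Fin.sum_univ_three, Matrix.one_apply] <;>
        ring) g
  rw [add_assoc (-s • eL)] at h1
  rw [rightDeriv_add, rightDeriv_add, rightDeriv_add, rightDeriv_add, rightDeriv_nilradical hF,
    rightDeriv_smul, rightDeriv_smul, rightDeriv_smul, rightDeriv_h₀ hF, rightDeriv_hL hF] at h1 h2
  rw [rightDeriv_eL hF, ContinuousLinearMap.id_apply] at h1
  rw [rightDeriv_fL hF, ContinuousLinearMap.id_apply] at h2
  rw [diracSmooth_apply, diracSmooth_apply, h1, h2]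
  simp only [map_add, map_smul, map_neg, map_zero, schwDerq_schwMulq]
  push_cast
  -- For a general twist `μ` the leftover terms would be `i s (3/4 - μ) q` and `t (μ - 3/4) ∂_q`;
  -- this is where the value `3/4` is forced.
  match_scalars <;> first | ring1 | (ring_nf; simp only [Complex.I_sq]; ring1)

end generators

theorem diracSmooth_mem_principalSeries {F : smoothFunctions} (hF : F ∈ principalSeries (3 / 4)) :
    diracSmooth F ∈ principalSeries (9 / 4) := by
  refine mem_principalSeries.2 fun pT hp => ?_
  induction hp using Submonoid.closure_induction with
  | mem pT h =>
    obtain ⟨p, T⟩ := pT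
    intro g
    cases h with
    | e t _ hp => exact apply_diracSmooth_e hF hp g
    | h t _ hp => exact apply_diracSmooth_h hF hp g
    | f t _ hp => exact apply_diracSmooth_f hF hp g
    | h₀ t _ hp => exact apply_diracSmooth_h₀ hF hp g
    | u t s _ hp => exact apply_diracSmooth_u hF hp g
  | one =>
    intro g
    simp
  | mul a b _ _ ha hb =>
    intro g
    have h := hb (g * a.1)
    change a.2 (b.2 ((diracSmooth F : Gt → Schw) (g * (a.1 * b.1)))) = _
    rw [← mul_assoc, h, ha]

/-! ## The symplectic Dirac operator between the principal series -/

/-- The symplectic Dirac operator on the principal series. -/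
def dirac : principalSeries (3 / 4) →ₗ[ℂ] principalSeries (9 / 4) :=
  diracSmooth.restrict fun _ => diracSmooth_mem_principalSeries

theorem sectionFun_dirac (F : principalSeries (3 / 4)) (g : Gt) :
    sectionFun (dirac F) g = Complex.I • schwMulq ((rightDeriv f₂ F : Gt → Schw) g) -
      schwDerq ((rightDeriv f₁ F : Gt → Schw) g) := rfl

theorem principalSeries_ext {μ : ℝ} {F K : principalSeries μ}
    (h : ∀ g, sectionFun F g = sectionFun K g) : F = K :=
  Subtype.ext (Subtype.ext (funext h))

theorem sectionFun_principalSeriesRep {μ : ℝ} (k : Gt) (F : principalSeries μ) (g : Gt) :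
    sectionFun (principalSeriesRep μ k F) g = sectionFun F (k⁻¹ * g) := rfl

theorem rightDeriv_principalSeriesRep {μ : ℝ} (X : sl3 ℝ) (k : Gt) (F : principalSeries μ)
    (g : Gt) : (rightDeriv X (principalSeriesRep μ k F : principalSeries μ) : Gt → Schw) g =
      (rightDeriv X F : Gt → Schw) (k⁻¹ * g) := by
  refine rightDeriv_eq_of_hasVelocity ?_
  have h := rightDeriv_spec X F (k⁻¹ * g)
  simp only [mul_assoc] at h
  exact h

/-- The operator is built from right derivatives and fibrewise operators, both of which commute with
left translation. -/
theorem dirac_principalSeriesRep (k : Gt) (F : principalSeries (3 / 4)) :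
    dirac (principalSeriesRep (3 / 4) k F) = principalSeriesRep (9 / 4) k (dirac F) := by
  refine principalSeries_ext fun g => ?_
  rw [sectionFun_principalSeriesRep, sectionFun_dirac, sectionFun_dirac,
    rightDeriv_principalSeriesRep, rightDeriv_principalSeriesRep]

theorem isDifferentialOperator_dirac : IsDifferentialOperator 1 dirac := by
  intro F g h
  have h1 := h [f₁] (by simp)
  have h2 := h [f₂] (by simp)
  simp only [List.map_cons, List.map_nil, List.prod_cons, List.prod_nil, mul_one] at h1 h2
  rw [sectionFun_dirac, h1, h2]
  simp

/-- The elements `f₁, f₂` commute, so on the open cell `R(f₁)` and `R(f₂)` are the partial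
derivatives in `x̂` and `ŷ`. -/
theorem isSymplecticDirac_dirac : IsSymplecticDirac dirac := by
  intro F x y
  have hc (a b c d : ℝ) : Commute ((a • f₁ + b • f₂ : sl3 ℝ) : Matrix (Fin 3) (Fin 3) ℝ)
      ((c • f₁ + d • f₂ : sl3 ℝ) : Matrix (Fin 3) (Fin 3) ℝ) := by
    ext i j
    fin_cases i <;> fin_cases j <;> simp [f₁, f₂, Matrix.mul_apply, Fin.sum_univ_three]
  have h (c d t : ℝ) : sectionFun F (expT (x • f₁ + y • f₂) * expT (t • (c • f₁ + d • f₂))) =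
      nonCompact F (x + t * c) (y + t * d) := by
    rw [nonCompact, smul_add, smul_smul, smul_smul, expT_add (hc _ _ _ _), add_smul, add_smul,
      add_add_add_comm]
  have h1 := rightDeriv_spec ((1 : ℝ) • f₁ + (0 : ℝ) • f₂) F (expT (x • f₁ + y • f₂))
  have h2 := rightDeriv_spec ((0 : ℝ) • f₁ + (1 : ℝ) • f₂) F (expT (x • f₁ + y • f₂))
  change HasVelocity (fun t => sectionFun F _) _ at h1
  change HasVelocity (fun t => sectionFun F _) _ at h2
  simp only [h] at h1 h2
  simp only [mul_one, mul_zero, add_zero, one_smul, zero_smul, zero_add] at h1 h2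
  exact ⟨_, _, h2, h1.clm schwDerq, rfl⟩

/-- The origin of the cell is the identity of `G̃`, where uniqueness of velocities makes the values
agree; translating `F` by `g⁻¹` carries the agreement to `g`. -/
theorem eq_of_isSymplecticDirac {μ ν : ℝ} {D D' : principalSeries μ →ₗ[ℂ] principalSeries ν}
    (hD : ∀ k F, D (principalSeriesRep μ k F) = principalSeriesRep ν k (D F))
    (hD' : ∀ k F, D' (principalSeriesRep μ k F) = principalSeriesRep ν k (D' F))
    (h : IsSymplecticDirac D) (h' : IsSymplecticDirac D') : D' = D := by
  have h1 (F : principalSeries μ) : sectionFun (D' F) 1 = sectionFun (D F) 1 := by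
    obtain ⟨φ, ψ, hφ, hψ, e⟩ := h F 0 0
    obtain ⟨φ', ψ', hφ', hψ', e'⟩ := h' F 0 0
    rw [hφ'.unique hφ, hψ'.unique hψ, ← e] at e'
    simpa [nonCompact, expT_zero] using e'
  refine LinearMap.ext fun F => principalSeries_ext fun g => ?_
  have h2 := h1 (principalSeriesRep μ g⁻¹ F)
  rw [hD, hD', sectionFun_principalSeriesRep, sectionFun_principalSeriesRep] at h2
  simpa using h2

/-! ## The pairing with the generalized Verma module -/

theorem schwPairing_apply (p : ℂ[X]) (r : Schw) :
    schwPairing p r = (aeval (schwDerq : Module.End ℂ Schw) p r) 0 := rfl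

theorem schwPairing_X_mul (p : ℂ[X]) (r : Schw) :
    schwPairing (X * p) r = schwPairing p (schwDerq r) := by
  rw [schwPairing_apply, mul_comm, map_mul, aeval_X]
  rfl

theorem schwPairing_derivative (p : ℂ[X]) (r : Schw) :
    schwPairing (derivative p) r = schwPairing p (schwMulq r) := by
  have hw : (schwDerq : Module.End ℂ Schw) * (schwMulq : Module.End ℂ Schw) =
      (schwMulq : Module.End ℂ Schw) * (schwDerq : Module.End ℂ Schw) + 1 :=
    LinearMap.ext schwDerq_schwMulq
  have h := congrArg (fun A : Module.End ℂ Schw => A r 0) (aeval_mul_eq hw p)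
  have h0 (ψ : Schw) : schwMulq ψ 0 = 0 := by simp [schwMulq_apply]
  simp only [Module.End.mul_apply, LinearMap.add_apply, _root_.add_apply,
    ContinuousLinearMap.coe_coe, h0, zero_add] at h
  exact h.symm

theorem vermaPairing_X_tmul (i : Fin 2) (p : ℂ[X]) (F : smoothFunctions) :
    vermaPairing (MvPolynomial.X i ⊗ₜ p) F =
      -schwPairing p ((rightDeriv (![f₁, f₂] i) F : Gt → Schw) 1) := by
  have h : (MvPolynomial.X i : MvPolynomial (Fin 2) ℂ) =
      MvPolynomial.basisMonomials (Fin 2) ℂ (Finsupp.single i 1) := by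
    simp [MvPolynomial.X]
  rw [vermaPairing, TensorProduct.lift.tmul, h, Module.Basis.constr_basis]
  fin_cases i <;> simp

/-- `X_s (1 ⊗ v)` has degree one in `x, y`, so only first right derivatives at the identity enter;
the factor `i` comes from `-1 = i · i` in the `f₂` term. -/
theorem vermaPairing_Xs (v : ℂ[X]) (F : principalSeries (3 / 4)) :
    vermaPairing (Xs (1 ⊗ₜ v)) F = Complex.I * schwPairing v (sectionFun (dirac F) 1) := by
  rw [Xs_one_tmul, map_add, map_smul, LinearMap.add_apply, LinearMap.smul_apply,
    vermaPairing_X_tmul, vermaPairing_X_tmul, schwPairing_derivative, schwPairing_X_mul,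
    sectionFun_dirac, map_sub, map_smul]
  simp only [Matrix.cons_val_one, Matrix.cons_val_zero, smul_eq_mul]
  linear_combination -schwPairing v (schwMulq ((rightDeriv f₂ F : Gt → Schw) 1)) * Complex.I_sq

end SympDirac

end

theorem mainTheorem5 :
    -- the restricted dual of the twisted metaplectic module is the twisted dual metaplectic module
    (∀ μ : ℂ, ∃ Ψ : Polynomial ℂ ≃ₗ[ℂ]
        SympDirac.restrictedDual (SympDirac.sigma μ (SympDirac.complexify SympDirac.hL)),
      (∀ r v, (Ψ r : Module.Dual ℂ (Polynomial ℂ)) v = SympDirac.spinPairing v r) ∧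
      ∀ Z ∈ SympDirac.parabolic ℂ, ∀ r v,
        (Ψ (SympDirac.sigmaDual (-μ) Z r) : Module.Dual ℂ (Polynomial ℂ)) v =
          -(Ψ r : Module.Dual ℂ (Polynomial ℂ)) (SympDirac.sigma μ Z v)) ∧
    -- the vectors `X_s v`, `v ∈ 𝕊`, are singular, and span a copy of the module with twist `-9/4`
    ((∀ v : Polynomial ℂ, SympDirac.Xs (1 ⊗ₜ[ℂ] v) ∈ SympDirac.Sol (3 / 4)) ∧
      Function.Injective (fun v : Polynomial ℂ => SympDirac.Xs (1 ⊗ₜ[ℂ] v)) ∧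
      ∀ Z ∈ SympDirac.parabolic ℂ, ∀ v : Polynomial ℂ,
        SympDirac.piHat (3 / 4) Z (SympDirac.Xs (1 ⊗ₜ[ℂ] v)) =
          SympDirac.Xs (1 ⊗ₜ[ℂ] SympDirac.sigma (-9 / 4) Z v)) ∧
    -- `X_s` is the corresponding homomorphism of generalized Verma modules, whose transpose under
    -- the invariant duality with `𝕊*`-valued functions is `i D_s`
    ((∀ (lam : ℂ) (Z : SympDirac.sl3 ℂ) (T : SympDirac.VermaSpace) (φ : SympDirac.Field),
        SympDirac.distPairing (SympDirac.piHat lam Z T) φ =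
          -SympDirac.distPairing T (SympDirac.piDual (-lam) Z φ)) ∧
      (∀ Z : SympDirac.sl3 ℂ,
        SympDirac.Xs * SympDirac.piHat (-3 / 4) Z = SympDirac.piHat (3 / 4) Z * SympDirac.Xs) ∧
      ∀ (T : SympDirac.VermaSpace) (φ : SympDirac.Field),
        SympDirac.distPairing (SympDirac.Xs T) φ =
          Complex.I * SympDirac.distPairing T (SympDirac.Ds φ)) ∧
    -- the `S̃L(3, ℝ)`-equivariant differential operator between the principal series
    (∃ D : SympDirac.principalSeries (3 / 4) →ₗ[ℂ] SympDirac.principalSeries (9 / 4),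
      (∀ g F, D (SympDirac.principalSeriesRep (3 / 4) g F) =
        SympDirac.principalSeriesRep (9 / 4) g (D F)) ∧
      SympDirac.IsDifferentialOperator 1 D ∧
      SympDirac.IsSymplecticDirac D ∧
      (∀ (v : Polynomial ℂ) (F : SympDirac.principalSeries (3 / 4)),
        SympDirac.vermaPairing (SympDirac.Xs (1 ⊗ₜ[ℂ] v)) F =
          Complex.I * SympDirac.schwPairing v (SympDirac.sectionFun (D F) 1)) ∧
      ∀ D' : SympDirac.principalSeries (3 / 4) →ₗ[ℂ] SympDirac.principalSeries (9 / 4),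
        (∀ g F, D' (SympDirac.principalSeriesRep (3 / 4) g F) =
          SympDirac.principalSeriesRep (9 / 4) g (D' F)) →
        SympDirac.IsSymplecticDirac D' → D' = D) ∧
    -- the infinitesimal intertwining property
    ∀ X : SympDirac.sl3 ℝ,
      SympDirac.Ds * SympDirac.piDual (-3 / 4) (SympDirac.complexify X) =
        SympDirac.piDual (3 / 4) (SympDirac.complexify X) * SympDirac.Ds := by
  open SympDirac in
  exact ⟨fun μ => ⟨restrictedDualEquiv μ, restrictedDualEquiv_apply μ, fun Z _ r v =>
      spinPairing_sigmaDual μ Z r v⟩,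
    ⟨Xs_one_tmul_mem_Sol, injective_Xs_one_tmul, fun _ hZ v => piHat_Xs_one_tmul hZ v⟩,
    ⟨distPairing_piHat, fun Z => Xs_mul_piHat (mem_sl3.1 Z.2), distPairing_Xs⟩,
    ⟨dirac, dirac_principalSeriesRep, isDifferentialOperator_dirac, isSymplecticDirac_dirac,
      vermaPairing_Xs, fun _ hD' h' =>
        eq_of_isSymplecticDirac dirac_principalSeriesRep hD' isSymplecticDirac_dirac h'⟩,
    Ds_mul_piDual⟩
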